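/- **Language.** Let $Var$ be a (finite or infinite) set of basic variables and $Pred$ a set of predicate symbols, each $P$ with an arity $ar(P)\in\mathbb N$. Formulas are given by $$\varphi ::= P x_1\ldots x_n \mid \neg\varphi \mid \varphi\wedge\varphi \mid D_X\varphi \mid K_X\varphi \mid D_XY \mid K_XY,$$ where $n=ar(P)$, $x_i\in Var$, and $X,Y$ are finite subsets of $Var$; $\varphi\to\psi$ abbreviates $\neg(\varphi\wedge\neg\psi)$. **Models.** A *topo-dependence model* consists of a set $\mathbb D_x$ with a $T_0$ topology $\tau_x$ for each $x\in Var$, a relation $I(P)$ of arity $ar(P)$ on $\bigcup_x\mathbb D_x$ for each $P\in Pred$, a set $S$ of states, and a surjection $\mathbf x:S\to\mathbb D_x$ for each $x\in Var$. For finite $X\subseteq Var$ put $\mathbf X(s)=(\mathbf x(s))_{x\in X}$, let $\mathbb D_X=\mathbf X(S)\subseteq\prod_{x\in X}\mathbb D_x$ carry the subspace topology of the product topology, and let $\tau_X^S=\{\mathbf X^{-1}(U): U \text{ open in }\mathbb D_X\}$. Truth at a state $s$ is defined by the usual Boolean clauses and: - $s\models Px_1\ldots x_n$ iff $(\mathbf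 x_1(s),\ldots,\mathbf x_n(s))\in I(P)$; - $s\models D_X\varphi$ iff $w\models\varphi$ for all $w\in S$ with $\mathbf X(w)=\mathbf X(s)$; - $s\models D_XY$ iff $\mathbf Y(w)=\mathbf Y(s)$ for all $w\in S$ with $\mathbf X(w)=\mathbf X(s)$; - $s\models K_X\varphi$ iff $s$ lies in the $\tau_X^S$-interior of $\{w\in S: w\models\varphi\}$; - $s\models K_XY$ iff there are $O\in\tau_X^S$ with $s\in O$ and a continuous $F:\mathbf X(O)\to\mathbb D_Y$ with $F\circ\mathbf X=\mathbf Y$ on $O$. A *metric dependence model* is a topo-dependence model in which each $\tau_x$ is the topology of a designated metric $d_x$ on $\mathbb D_x$. A *concrete topo-dependence model* is one in which $S\subseteq\prod_{x\in Var}\mathbb D_x$ and $\mathbf x(s)=s(x)$. A map $F$ between pseudo-metric spaces is *pseudo-locally Lipschitz* if every point $p$ of its domain has an open neighbourhood $O$, and $F(p)$ has an open neighbourhood $U$, such that $F$ is Lipschitz on $O\cap F^{-1}(U)$. A metric dependence model is *pseudo-locally Lipschitz* if for all $x,y\in Var$ with $\mathbf x$ not constant on $S$, the map $\mathbf y:(S,d_x^S)\to(\mathbb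 D_y,d_y)$ is pseudo-locally Lipschitz, where $d_x^S(s,w)=d_x(\mathbf x(s),\mathbf x(w))$. A formula is *valid* on a class of models if it is true at every state of every model of the class. **Proof system $\mathbf{LCD}$.** Axioms and rules, for all formulas $\varphi,\psi$ and finite $X,Y,Z\subseteq Var$: - all instances of propositional tautologies, and modus ponens; - from $\varphi$ infer $D_X\varphi$; $D_X(\varphi\to\psi)\to(D_X\varphi\to D_X\psi)$; $D_X\varphi\to\varphi$; $D_X\varphi\to D_XD_X\varphi$; $\neg D_X\varphi\to D_X\neg D_X\varphi$; - $D_XY$ for $Y\subseteq X$; $(D_XY\wedge D_XZ)\to D_X(Y\cup Z)$; $(D_XY\wedge D_YZ)\to D_XZ$; $D_XY\to D_XD_XY$; $D_XY\to(D_Y\varphi\to D_X\varphi)$; $Px_1\ldots x_n\to D_{\{x_1,\ldots,x_n\}}Px_1\ldots x_n$; - from $\varphi$ infer $K_X\varphi$; $K_X(\varphi\to\psi)\to(K_X\varphi\to K_X\psi)$; $K_X\varphi\to\varphi$; $K_X\varphi\to K_XK_X\varphi$; - $K_XY$ for $Y\subseteq X$; $(K_XY\wedge K_XZ)\to K_X(Y\cup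 Z)$; $(K_XY\wedge K_YZ)\to K_XZ$; $K_XY\to K_XK_XY$; $K_XY\to(K_Y\varphi\to K_X\varphi)$; - $K_X\varphi\to D_X\varphi$; $K_XY\to D_XY$; $D_\emptyset\varphi\to K_\emptyset\varphi$; $D_\emptyset Y\to K_\emptyset Y$. **Theorem.** For every formula $\varphi$ the following are equivalent: $\varphi$ is provable in $\mathbf{LCD}$; $\varphi$ is valid on (a) all topo-dependence models; (b) all metric dependence models; (c) all concrete topo-dependence models; (d) all pseudo-locally Lipschitz metric dependence models. Moreover the logic $\mathsf{LCD}$, i.e. the set of valid formulas, is decidable: if $Var$ and $Pred$ are countable and numbered by natural numbers, and formulas are coded by natural numbers accordingly, then there is a total computable function that, given the code of a formula $\varphi$, decides whether $\varphi$ is valid on all topo-dependence models. -/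

import Mathlib

universe u v w w'

namespace LCD

/-! ### Syntax -/

/-- Formulas over the basic variables `Var` and the predicate symbols `Pred` with arities `ar`:
`P x₁ … xₙ`, `¬ φ`, `φ ∧ ψ`, `D_X φ`, `K_X φ`, `D_X Y`, `K_X Y`, with `X`, `Y` finite sets. -/
inductive Formula (Var : Type u) (Pred : Type v) (ar : Pred → ℕ) : Type (max u v)
  | atom (P : Pred) (xs : Fin (ar P) → Var) : Formula Var Pred ar
  | neg (φ : Formula Var Pred ar) : Formula Var Pred ar
  | and (φ ψ : Formula Var Pred ar) : Formula Var Pred ar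
  | dmod (X : Finset Var) (φ : Formula Var Pred ar) : Formula Var Pred ar
  | kmod (X : Finset Var) (φ : Formula Var Pred ar) : Formula Var Pred ar
  | ddep (X Y : Finset Var) : Formula Var Pred ar
  | kdep (X Y : Finset Var) : Formula Var Pred ar

namespace Formula

variable {Var : Type u} {Pred : Type v} {ar : Pred → ℕ}

/-- Material implication. -/
def imp (φ ψ : Formula Var Pred ar) : Formula Var Pred ar := neg (and φ (neg ψ))

/-- `φ` is an instance of a propositional tautology: it is true under every assignment of truth
values to formulas that respects the Boolean connectives. -/
def IsTautology (φ : Formula Var Pred ar) : Prop :=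
  ∀ val : Formula Var Pred ar → Prop,
    (∀ α, val (neg α) ↔ ¬ val α) →
    (∀ α β, val (and α β) ↔ (val α ∧ val β)) → val φ

/-- Gödel numbering of formulas, from numberings of the variables and the predicate symbols. -/
def code [Encodable Var] [Encodable Pred] : Formula Var Pred ar → ℕ
  | atom P xs => Nat.pair 0 (Nat.pair (Encodable.encode P) (Encodable.encode (List.ofFn xs)))
  | neg φ => Nat.pair 1 (code φ)
  | and φ ψ => Nat.pair 2 (Nat.pair (code φ) (code ψ))
  | dmod X φ => Nat.pair 3 (Nat.pair (Encodable.encode X) (code φ))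
  | kmod X φ => Nat.pair 4 (Nat.pair (Encodable.encode X) (code φ))
  | ddep X Y => Nat.pair 5 (Nat.pair (Encodable.encode X) (Encodable.encode Y))
  | kdep X Y => Nat.pair 6 (Nat.pair (Encodable.encode X) (Encodable.encode Y))

end Formula

/-! ### The proof system -/

open Formula in
/-- Theorems of the proof system **LCD**. -/
inductive Provable {Var : Type u} {Pred : Type v} {ar : Pred → ℕ} [DecidableEq Var] :
    Formula Var Pred ar → Prop
  -- propositional logic
  | taut {φ} : IsTautology φ → Provable φ
  | modusPonens {φ ψ} : Provable (imp φ ψ) → Provable φ → Provable ψ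
  -- S5 for determination
  | dNec (X : Finset Var) {φ} : Provable φ → Provable (dmod X φ)
  | dDist (X : Finset Var) (φ ψ) :
      Provable (imp (dmod X (imp φ ψ)) (imp (dmod X φ) (dmod X ψ)))
  | dT (X : Finset Var) (φ) : Provable (imp (dmod X φ) φ)
  | d4 (X : Finset Var) (φ) : Provable (imp (dmod X φ) (dmod X (dmod X φ)))
  | d5 (X : Finset Var) (φ) : Provable (imp (neg (dmod X φ)) (dmod X (neg (dmod X φ))))
  -- exact dependence
  | dIncl (X Y : Finset Var) : Y ⊆ X → Provable (ddep X Y)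
  | dAdd (X Y Z : Finset Var) : Provable (imp (and (ddep X Y) (ddep X Z)) (ddep X (Y ∪ Z)))
  | dTrans (X Y Z : Finset Var) : Provable (imp (and (ddep X Y) (ddep Y Z)) (ddep X Z))
  | determinedDep (X Y : Finset Var) : Provable (imp (ddep X Y) (dmod X (ddep X Y)))
  | dTransfer (X Y : Finset Var) (φ) :
      Provable (imp (ddep X Y) (imp (dmod Y φ) (dmod X φ)))
  | determinedAtoms (P : Pred) (xs : Fin (ar P) → Var) :
      Provable (imp (atom P xs) (dmod (Finset.univ.image xs) (atom P xs)))
  -- S4 for knowability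
  | kNec (X : Finset Var) {φ} : Provable φ → Provable (kmod X φ)
  | kDist (X : Finset Var) (φ ψ) :
      Provable (imp (kmod X (imp φ ψ)) (imp (kmod X φ) (kmod X ψ)))
  | veracity (X : Finset Var) (φ) : Provable (imp (kmod X φ) φ)
  | posIntro (X : Finset Var) (φ) : Provable (imp (kmod X φ) (kmod X (kmod X φ)))
  -- knowable dependence
  | kIncl (X Y : Finset Var) : Y ⊆ X → Provable (kdep X Y)
  | kAdd (X Y Z : Finset Var) : Provable (imp (and (kdep X Y) (kdep X Z)) (kdep X (Y ∪ Z)))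
  | kTrans (X Y Z : Finset Var) : Provable (imp (and (kdep X Y) (kdep Y Z)) (kdep X Z))
  | knowabilityOfDep (X Y : Finset Var) : Provable (imp (kdep X Y) (kmod X (kdep X Y)))
  | kTransfer (X Y : Finset Var) (φ) :
      Provable (imp (kdep X Y) (imp (kmod Y φ) (kmod X φ)))
  -- connecting axioms
  | knowableDetermination (X : Finset Var) (φ) : Provable (imp (kmod X φ) (dmod X φ))
  | knowableDependence (X Y : Finset Var) : Provable (imp (kdep X Y) (ddep X Y))
  | knowledgeOfNecessity (φ) : Provable (imp (dmod ∅ φ) (kmod ∅ φ))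
  | knowledgeOfConstants (Y : Finset Var) : Provable (imp (ddep ∅ Y) (kdep ∅ Y))

/-! ### Models -/

/-- A typed topological model: value ranges `D x` (sets of values of an ambient type, possibly
overlapping), a topology on each, and an interpretation of each predicate symbol as a relation on
the union of the ranges. -/
structure TypedTopModel (Var : Type u) (Pred : Type v) (ar : Pred → ℕ) where
  Value : Type w
  D : Var → Set Value
  top : ∀ x, TopologicalSpace (D x)
  I : ∀ P : Pred, Set (Fin (ar P) → ↥(⋃ x, D x))

/-- A topo-dependence model: each basic variable denotes an empirical variable, i.e. a surjective
map from the states to a T₀ space. -/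
structure TopoDepModel (Var : Type u) (Pred : Type v) (ar : Pred → ℕ)
    extends TypedTopModel.{u, v, w} Var Pred ar where
  State : Type w'
  val : ∀ x, State → D x
  surj : ∀ x, Function.Surjective (val x)
  t0 : ∀ x, @T0Space (D x) (top x)

namespace TopoDepModel

variable {Var : Type u} {Pred : Type v} {ar : Pred → ℕ} (M : TopoDepModel.{u, v, w, w'} Var Pred ar)

instance (x : Var) : TopologicalSpace (M.D x) := M.top x

/-- The joint variable `𝐗 : S → ∏_{x ∈ X} D x`; its value space is `Set.range (M.joint X)` with
the subspace topology of the product topology. -/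
def joint (X : Finset Var) (s : M.State) : ∀ x : X, M.D x := fun x => M.val x s

/-- The (weak) `X`-topology on states. -/
abbrev stateTop (X : Finset Var) : TopologicalSpace M.State :=
  TopologicalSpace.induced (M.joint X) inferInstance

/-- Truth of a formula at a state. -/
def Sat : M.State → Formula Var Pred ar → Prop
  | s, .atom P xs =>
      (fun i => (⟨(M.val (xs i) s : M.Value),
        Set.mem_iUnion_of_mem (xs i) (M.val (xs i) s).2⟩ : ↥(⋃ x, M.D x))) ∈ M.I P
  | s, .neg φ => ¬ Sat s φ
  | s, .and φ ψ => Sat s φ ∧ Sat s ψ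
  | s, .dmod X φ => ∀ t, M.joint X s = M.joint X t → Sat t φ
  | s, .kmod X φ => s ∈ @interior M.State (M.stateTop X) {t | Sat t φ}
  | s, .ddep X Y => ∀ t, M.joint X s = M.joint X t → M.joint Y s = M.joint Y t
  | s, .kdep X Y => ∃ O : Set M.State, @IsOpen M.State (M.stateTop X) O ∧ s ∈ O ∧
      ∃ F : ↥(M.joint X '' O) → ↥(Set.range (M.joint Y)), Continuous F ∧
        ∀ t (ht : t ∈ O),
          F ⟨M.joint X t, Set.mem_image_of_mem _ ht⟩ = ⟨M.joint Y t, Set.mem_range_self t⟩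

/-- Truth at all states of the model. -/
def GloballyTrue (φ : Formula Var Pred ar) : Prop := ∀ s, M.Sat s φ

end TopoDepModel

/-- A metric dependence model: the value ranges carry designated metrics. -/
structure MetricDepModel (Var : Type u) (Pred : Type v) (ar : Pred → ℕ) where
  Value : Type w
  D : Var → Set Value
  metric : ∀ x, MetricSpace (D x)
  I : ∀ P : Pred, Set (Fin (ar P) → ↥(⋃ x, D x))
  State : Type w'
  val : ∀ x, State → D x
  surj : ∀ x, Function.Surjective (val x)

/-- `F` is pseudo-locally Lipschitz: every point `x` has an open neighbourhood `O`, and `F x` an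
open neighbourhood `U`, such that `F` is Lipschitz on `O ∩ F⁻¹(U)`. -/
def PseudoLocallyLipschitz {D E : Type*} [PseudoMetricSpace D] [PseudoMetricSpace E]
    (F : D → E) : Prop :=
  ∀ x, ∃ O : Set D, IsOpen O ∧ x ∈ O ∧ ∃ U : Set E, IsOpen U ∧ F x ∈ U ∧
    ∃ C : NNReal, LipschitzOnWith C F (O ∩ F ⁻¹' U)

namespace MetricDepModel

variable {Var : Type u} {Pred : Type v} {ar : Pred → ℕ}
  (M : MetricDepModel.{u, v, w, w'} Var Pred ar)

instance (x : Var) : MetricSpace (M.D x) := M.metric x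

/-- The underlying topo-dependence model, with the metric topologies. -/
def toTopoDepModel : TopoDepModel.{u, v, w, w'} Var Pred ar where
  Value := M.Value
  D := M.D
  top := fun _ => inferInstance
  I := M.I
  State := M.State
  val := M.val
  surj := M.surj
  t0 := fun _ => inferInstance

/-- The pseudo-metric `d_x^S(s, t) = d_x(𝐱(s), 𝐱(t))` on states. -/
abbrev statePseudoMetric (x : Var) : PseudoMetricSpace M.State :=
  PseudoMetricSpace.induced (M.val x) inferInstance

/-- `𝐱` takes the same value at all states. -/
def IsConstant (x : Var) : Prop := ∀ s t, M.val x s = M.val x t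

/-- Pseudo-locally Lipschitz models: for all basic variables `x`, `y` with `𝐱` not constant, the map
`𝐲 : (S, d_x^S) → (D y, d_y)` is pseudo-locally Lipschitz. A constant `𝐱` carries the same zero
pseudo-metric as the empty joint variable and, like that one, imposes no condition. -/
def IsPseudoLocallyLipschitz : Prop :=
  ∀ x y : Var, ¬ M.IsConstant x →
    @PseudoLocallyLipschitz M.State (M.D y) (M.statePseudoMetric x) inferInstance (M.val y)

end MetricDepModel

/-- A concrete topo-dependence model: the states are assignments of values to variables. -/
structure ConcreteModel (Var : Type u) (Pred : Type v) (ar : Pred → ℕ)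
    extends TypedTopModel.{u, v, w} Var Pred ar where
  states : Set (∀ x, D x)
  surj : ∀ x (d : D x), ∃ s ∈ states, s x = d
  t0 : ∀ x, @T0Space (D x) (top x)

/-- A concrete model as a topo-dependence model, with `𝐱(s) = s(x)`. -/
def ConcreteModel.toTopoDepModel {Var : Type u} {Pred : Type v} {ar : Pred → ℕ}
    (M : ConcreteModel.{u, v, w} Var Pred ar) : TopoDepModel.{u, v, w, max u w} Var Pred ar where
  toTypedTopModel := M.toTypedTopModel
  State := M.states
  val := fun x s => s.1 x
  surj := fun x d => let ⟨s, hs, h⟩ := M.surj x d; ⟨⟨s, hs⟩, h⟩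
  t0 := M.t0

/-! ### Validity on the four classes of models -/

section Validity

variable {Var : Type u} {Pred : Type v} {ar : Pred → ℕ}

def ValidTopo (φ : Formula Var Pred ar) : Prop :=
  ∀ M : TopoDepModel.{u, v, w, w'} Var Pred ar, M.GloballyTrue φ

def ValidMetric (φ : Formula Var Pred ar) : Prop :=
  ∀ M : MetricDepModel.{u, v, w, w'} Var Pred ar, M.toTopoDepModel.GloballyTrue φ

def ValidConcrete (φ : Formula Var Pred ar) : Prop :=
  ∀ M : ConcreteModel.{u, v, w} Var Pred ar, M.toTopoDepModel.GloballyTrue φ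

def ValidPseudoLocallyLipschitz (φ : Formula Var Pred ar) : Prop :=
  ∀ M : MetricDepModel.{u, v, w, w'} Var Pred ar, M.IsPseudoLocallyLipschitz →
    M.toTopoDepModel.GloballyTrue φ

end Validity

end LCD

/-! Soundness is filter algebra. `K_X φ` says that `φ` holds eventually along the neighbourhood
filter of the `X`-topology, and `K_X Y` says that eventually this filter refines the one of `Y`
(`sat_kmod`, `sat_kdep`). The T₀ axiom turns continuous dependence into functional dependence, which
gives `K_X Y → D_X Y`.

Completeness passes through finite relational structures (`Premodel`). An unprovable formula is
missing from some maximal consistent set. Take all maximal consistent sets with the same `D_∅`-facts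
and keep one for each trace on a finite set of formulas. The relations compare only formulas of that
finite set that are provably determined by, or knowable from, sets of variables on which `X` is
known to have control. Existing successors and all dependence laws thus survive the filtration
(`canonicalPremodel`, `exists_premodel`).

In a premodel equality and closeness are still abstract relations. To realise them by metrics,
unravel the premodel into its tree of histories. Each variable `x` gives each edge a length, and the
`x`-distance of two histories is the longest edge on the path between them, an ultrametric. Equality
steps have length 0 for the variables they fix. Closeness steps have the small length `1 / (e + 2)`
for the nonconstant variables they control, with `e` arbitrary. All other lengths are 1, except that
constants always see 0. Closeness is not symmetric, but a history has only finitely many edges above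
it, so a small enough ball around it crosses these edges only where their length is 0
(`exists_radius`). Inside that ball closeness is travelled in its own direction only, and truth at a
history is truth at its last state (`sat_historyModel`). All nonconstant controlled variables see a
closeness step with the same length, so the model is pseudo-locally Lipschitz with constant 1. Such
models are metric and topological, and identifying states with equal values makes them concrete, so
all four classes have the same logic.

For decidability, the size of the premodel is bounded primitive recursively in the code of the
formula. A premodel is stored in the bits of one bounded number, and checking it needs only bounded
quantifiers. Every coded premodel that passes the check unravels to a genuine countermodel
(`exists_natRefutes_iff`). -/

open Filter Topology

namespace LCD

/-! ### Soundness -/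

namespace TopoDepModel

/-! ### Truth clauses in terms of neighbourhood filters. -/

section Semantics

variable {Var : Type u} {Pred : Type v} {ar : Pred → ℕ}
  (M : TopoDepModel.{u, v, w, w'} Var Pred ar)

/-- The filter of neighbourhoods of a state in the `X`-topology. -/
def nhdsAt (X : Finset Var) (s : M.State) : Filter M.State := @nhds M.State (M.stateTop X) s

theorem nhdsAt_eq_comap (X : Finset Var) (s : M.State) :
    M.nhdsAt X s = comap (M.joint X) (𝓝 (M.joint X s)) :=
  nhds_induced _ _

theorem mem_of_mem_nhdsAt {X : Finset Var} {s : M.State} {A : Set M.State}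
    (h : A ∈ M.nhdsAt X s) : s ∈ A :=
  @mem_of_mem_nhds _ (M.stateTop X) _ _ h

theorem nhdsAt_congr {X : Finset Var} {s t : M.State} (h : M.joint X s = M.joint X t) :
    M.nhdsAt X s = M.nhdsAt X t := by
  rw [nhdsAt_eq_comap, nhdsAt_eq_comap, h]

theorem eventually_eventually_nhdsAt {X : Finset Var} {s : M.State} {p : M.State → Prop} :
    (∀ᶠ t in M.nhdsAt X s, ∀ᶠ t' in M.nhdsAt X t, p t') ↔ ∀ᶠ t in M.nhdsAt X s, p t :=
  @eventually_eventually_nhds _ (M.stateTop X) _ _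

theorem self_of_eventually {X : Finset Var} {s : M.State} {p : M.State → Prop}
    (h : ∀ᶠ t in M.nhdsAt X s, p t) : p s :=
  M.mem_of_mem_nhdsAt (A := {t | p t}) h

theorem eventually_of_joint_eq {X : Finset Var} {s t : M.State} {p : M.State → Prop}
    (h : ∀ᶠ t in M.nhdsAt X s, p t) (hst : M.joint X s = M.joint X t) : p t :=
  M.self_of_eventually (X := X) (by rwa [← M.nhdsAt_congr hst])

theorem nhdsAt_eq_iInf (X : Finset Var) (s : M.State) :
    M.nhdsAt X s = ⨅ x : X, comap (M.val x) (𝓝 (M.val x s)) := by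
  rw [nhdsAt_eq_comap, nhds_pi, Filter.pi, comap_iInf]
  refine iInf_congr fun x => ?_
  rw [comap_comap]; rfl

theorem nhdsAt_mono {X Y : Finset Var} (h : Y ⊆ X) (s : M.State) :
    M.nhdsAt X s ≤ M.nhdsAt Y s := by
  rw [nhdsAt_eq_iInf, nhdsAt_eq_iInf]
  exact le_iInf fun y => iInf_le_of_le ⟨y.1, h y.2⟩ le_rfl

theorem nhdsAt_union [DecidableEq Var] (X Y : Finset Var) (s : M.State) :
    M.nhdsAt X s ⊓ M.nhdsAt Y s ≤ M.nhdsAt (X ∪ Y) s := by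
  rw [nhdsAt_eq_iInf M (X ∪ Y)]
  refine le_iInf fun z => ?_
  rw [nhdsAt_eq_iInf, nhdsAt_eq_iInf]
  rcases Finset.mem_union.1 z.2 with hz | hz
  · exact inf_le_of_left_le (iInf_le_of_le ⟨z.1, hz⟩ le_rfl)
  · exact inf_le_of_right_le (iInf_le_of_le ⟨z.1, hz⟩ le_rfl)

theorem nhdsAt_empty (s : M.State) : M.nhdsAt ∅ s = ⊤ := by
  rw [nhdsAt_eq_iInf]
  exact iInf_of_empty _

theorem joint_eq_iff {X : Finset Var} {s t : M.State} :
    M.joint X s = M.joint X t ↔ ∀ x ∈ X, M.val x s = M.val x t :=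
  ⟨fun h x hx => congrFun h ⟨x, hx⟩, fun h => funext fun x => h x.1 x.2⟩

/-- Continuity of `𝐘` with respect to `𝐗` at a state makes `𝐘` a function of `𝐗` there, since the
value spaces are T₀. -/
theorem joint_eq_of_nhdsAt_le {X Y : Finset Var} {s t : M.State}
    (hs : M.nhdsAt X s ≤ M.nhdsAt Y s) (ht : M.nhdsAt X t ≤ M.nhdsAt Y t)
    (h : M.joint X s = M.joint X t) : M.joint Y s = M.joint Y t := by
  have := M.t0
  have key : ∀ {s t : M.State}, M.nhdsAt X s ≤ M.nhdsAt Y s → M.joint X s = M.joint X t →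
      ∀ U : Set (∀ y : Y, M.D y), IsOpen U → M.joint Y s ∈ U → M.joint Y t ∈ U := by
    intro s t hs h U hU hmem
    have h1 : M.joint Y ⁻¹' U ∈ M.nhdsAt Y s := by
      rw [nhdsAt_eq_comap]
      exact preimage_mem_comap (hU.mem_nhds hmem)
    have h2 : M.joint Y ⁻¹' U ∈ M.nhdsAt X t := by
      rw [← M.nhdsAt_congr h]
      exact hs h1
    exact M.mem_of_mem_nhdsAt h2
  -- T₀ needs both directions of inseparability, hence continuity at both states.
  refine Inseparable.eq (inseparable_iff_forall_isOpen.2 fun U hU => ⟨?_, ?_⟩)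
  · exact key hs h U hU
  · exact key ht h.symm U hU

theorem sat_neg {s : M.State} {φ : Formula Var Pred ar} :
    M.Sat s (.neg φ) ↔ ¬ M.Sat s φ := by
  rw [Sat]

theorem sat_and {s : M.State} {φ ψ : Formula Var Pred ar} :
    M.Sat s (.and φ ψ) ↔ M.Sat s φ ∧ M.Sat s ψ := by
  rw [Sat]

theorem sat_dmod {s : M.State} {X : Finset Var} {φ : Formula Var Pred ar} :
    M.Sat s (.dmod X φ) ↔ ∀ t, M.joint X s = M.joint X t → M.Sat t φ := by
  rw [Sat]

theorem sat_ddep {s : M.State} {X Y : Finset Var} :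
    M.Sat s (.ddep X Y) ↔ ∀ t, M.joint X s = M.joint X t → M.joint Y s = M.joint Y t := by
  rw [Sat]

theorem sat_kmod {s : M.State} {X : Finset Var} {φ : Formula Var Pred ar} :
    M.Sat s (.kmod X φ) ↔ ∀ᶠ t in M.nhdsAt X s, M.Sat t φ := by
  rw [Sat]
  exact @mem_interior_iff_mem_nhds _ (M.stateTop X) _ _

/-- A local continuous factorisation of `𝐘` through `𝐗` amounts to continuity of `𝐘` in the
`X`-topology near `s`. The factor map exists by the T₀ axiom, and it is continuous because `𝐗` is a
quotient map onto its image of an open set. -/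
theorem sat_kdep {s : M.State} {X Y : Finset Var} :
    M.Sat s (.kdep X Y) ↔ ∀ᶠ t in M.nhdsAt X s, M.nhdsAt X t ≤ M.nhdsAt Y t := by
  rw [Sat]
  let _ := M.stateTop X
  have hcX : Continuous (M.joint X) := continuous_induced_dom
  constructor
  · rintro ⟨O, hO, hs, F, hF, hFe⟩
    refine mem_of_superset (hO.mem_nhds hs) fun t ht => ?_
    have h1 : ContinuousOn (M.joint Y) O := by
      rw [continuousOn_iff_continuous_domRestrict]
      have : O.domRestrict (M.joint Y) = fun t : O =>
          (F ⟨M.joint X t, Set.mem_image_of_mem _ t.2⟩ : ∀ y : Y, M.D y) := by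
        funext t
        rw [hFe t.1 t.2]
        rfl
      rw [this]
      exact continuous_subtype_val.comp (hF.comp
        ((hcX.comp continuous_subtype_val).subtype_mk _))
    have h2 : Tendsto (M.joint Y) (M.nhdsAt X t) (𝓝 (M.joint Y t)) :=
      h1.continuousAt (hO.mem_nhds ht)
    show M.nhdsAt X t ≤ M.nhdsAt Y t
    rw [nhdsAt_eq_comap M Y]
    exact map_le_iff_le_comap.1 h2
  · intro h
    let O : Set M.State := interior {t | M.nhdsAt X t ≤ M.nhdsAt Y t}
    have hO : IsOpen O := isOpen_interior
    have hOsub : ∀ t ∈ O, M.nhdsAt X t ≤ M.nhdsAt Y t := fun t ht =>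
      interior_subset (s := {t | M.nhdsAt X t ≤ M.nhdsAt Y t}) ht
    let q : O → ↥(M.joint X '' O) := fun t => ⟨M.joint X t, Set.mem_image_of_mem _ t.2⟩
    have hqs : Function.Surjective q := by
      rintro ⟨_, t, ht, rfl⟩
      exact ⟨⟨t, ht⟩, rfl⟩
    have hqi : IsInducing q := by
      have h1 : IsInducing (fun t : O => M.joint X t) :=
        (IsInducing.induced (M.joint X)).comp IsInducing.subtypeVal
      exact IsInducing.of_comp (f := q) (g := Subtype.val)
        ((hcX.comp continuous_subtype_val).subtype_mk _) continuous_subtype_val h1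
    -- An inducing surjection is open, since each open set of its domain is a preimage.
    have hqq : IsQuotientMap q :=
      (hqi.isOpenMap (by rw [hqs.range_eq]; exact isOpen_univ)).isQuotientMap hqi.continuous hqs
    -- An arbitrary preimage is chosen; `hFe` shows that the value does not depend on it.
    let F : ↥(M.joint X '' O) → ↥(Set.range (M.joint Y)) := fun p =>
      ⟨M.joint Y (Function.surjInv hqs p).1, Set.mem_range_self _⟩
    have hFe : ∀ t : O, F (q t) = ⟨M.joint Y t, Set.mem_range_self _⟩ := by
      intro t
      have h1 := Function.surjInv_eq hqs (q t)
      have h2 : M.joint X (Function.surjInv hqs (q t)).1 = M.joint X t := congrArg Subtype.val h1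
      exact Subtype.ext (M.joint_eq_of_nhdsAt_le (hOsub _ (Subtype.prop _)) (hOsub _ t.2) h2)
    refine ⟨O, hO, ?_, F, ?_, fun t ht => hFe ⟨t, ht⟩⟩
    · exact mem_interior_iff_mem_nhds.2 h
    · rw [hqq.continuous_iff, Topology.IsInducing.subtypeVal.continuous_iff]
      have : Subtype.val ∘ F ∘ q = fun t : O => M.joint Y t := by
        funext t
        simp [hFe t]
      rw [this]
      refine (continuousOn_iff_continuous_domRestrict (f := M.joint Y)).1 fun t ht => ?_
      refine ContinuousAt.continuousWithinAt ?_
      have h3 := hOsub t ht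
      rw [nhdsAt_eq_comap M Y] at h3
      exact map_le_iff_le_comap.2 h3

theorem sat_imp {s : M.State} {φ ψ : Formula Var Pred ar} :
    M.Sat s (.imp φ ψ) ↔ (M.Sat s φ → M.Sat s ψ) := by
  simp [Formula.imp, Sat]

end Semantics

theorem soundness {Var : Type u} {Pred : Type v} {ar : Pred → ℕ} [DecidableEq Var]
    (M : TopoDepModel.{u, v, w, w'} Var Pred ar) {φ : Formula Var Pred ar} (h : Provable φ)
    (s : M.State) : M.Sat s φ := by
  induction h generalizing s with
  | taut h => exact h (M.Sat s) (fun _ => by rw [Sat]) (fun _ _ => by rw [Sat])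
  | modusPonens _ _ ih₁ ih₂ => exact M.sat_imp.1 (ih₁ s) (ih₂ s)
  | dNec X _ ih => rw [Sat]; exact fun t _ => ih t
  | dDist X φ ψ =>
    simp only [sat_imp, Sat]
    exact fun h₁ h₂ t ht => h₁ t ht (h₂ t ht)
  | dT X φ =>
    simp only [sat_imp, Sat]
    exact fun h => h s rfl
  | d4 X φ =>
    simp only [sat_imp, Sat]
    exact fun h t ht t' ht' => h t' (ht.trans ht')
  | d5 X φ =>
    simp only [sat_imp, Sat]
    exact fun h t ht h' => h fun t' ht' => h' t' (ht.symm.trans ht')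
  | dIncl X Y hY =>
    simp only [Sat, joint_eq_iff]
    exact fun t ht y hy => ht y (hY hy)
  | dAdd X Y Z =>
    simp only [sat_imp, Sat, joint_eq_iff]
    rintro ⟨h₁, h₂⟩ t ht y hy
    rcases Finset.mem_union.1 hy with hy | hy
    · exact h₁ t ht y hy
    · exact h₂ t ht y hy
  | dTrans X Y Z =>
    simp only [sat_imp, Sat]
    exact fun h t ht => h.2 t (h.1 t ht)
  | determinedDep X Y =>
    simp only [sat_imp, Sat]
    exact fun h t ht t' ht' => (h t ht).symm.trans (h t' (ht.trans ht'))
  | dTransfer X Y φ =>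
    simp only [sat_imp, Sat]
    exact fun h₁ h₂ t ht => h₂ t (h₁ t ht)
  | determinedAtoms P xs =>
    simp only [sat_imp, Sat, joint_eq_iff]
    intro h t ht
    convert h using 4 with i
    exact (ht (xs i) (by simp)).symm
  | kNec X _ ih => exact M.sat_kmod.2 (Eventually.of_forall ih)
  | kDist X φ ψ =>
    simp only [sat_imp, sat_kmod]
    exact fun h₁ h₂ => h₁.mp (h₂.mono fun t h h' => h' h)
  | veracity X φ =>
    simp only [sat_imp, sat_kmod]
    exact M.self_of_eventually
  | posIntro X φ =>
    simp only [sat_imp, sat_kmod]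
    exact M.eventually_eventually_nhdsAt.2
  | kIncl X Y hY =>
    exact M.sat_kdep.2 (Eventually.of_forall fun t => M.nhdsAt_mono hY t)
  | kAdd X Y Z =>
    rw [sat_imp, Sat]
    simp only [sat_kdep]
    rintro ⟨h₁, h₂⟩
    filter_upwards [h₁, h₂] with t h₁ h₂
    exact (le_inf h₁ h₂).trans (M.nhdsAt_union Y Z t)
  | kTrans X Y Z =>
    rw [sat_imp, Sat]
    simp only [sat_kdep]
    rintro ⟨h₁, h₂⟩
    -- `h₂` holds eventually for `Y`; the refinement of filters at `s` itself makes it hold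
    -- eventually for `X`.
    filter_upwards [h₁, M.self_of_eventually h₁ h₂] with t h₁ h₂
    exact h₁.trans h₂
  | knowabilityOfDep X Y =>
    simp only [sat_imp, sat_kmod, sat_kdep]
    exact M.eventually_eventually_nhdsAt.2
  | kTransfer X Y φ =>
    simp only [sat_imp, sat_kmod, sat_kdep]
    exact fun h₁ h₂ => M.self_of_eventually h₁ h₂
  | knowableDetermination X φ =>
    simp only [sat_imp, sat_kmod, sat_dmod]
    exact fun h t ht => M.eventually_of_joint_eq h ht
  | knowableDependence X Y =>
    simp only [sat_imp, sat_kdep, sat_ddep]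
    exact fun h t ht => M.joint_eq_of_nhdsAt_le (M.self_of_eventually h)
      (M.eventually_of_joint_eq h ht) ht
  | knowledgeOfNecessity φ =>
    simp only [sat_imp, sat_kmod, sat_dmod, nhdsAt_empty]
    exact fun h => eventually_top.2 fun t =>
      h t (M.joint_eq_iff.2 fun x hx => absurd hx (Finset.notMem_empty x))
  | knowledgeOfConstants Y =>
    simp only [sat_imp, sat_kdep, sat_ddep, nhdsAt_empty]
    intro h
    have h' : ∀ t, M.joint Y s = M.joint Y t :=
      fun t => h t (M.joint_eq_iff.2 fun x hx => absurd hx (Finset.notMem_empty x))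
    -- `𝐘` is constant, so all states have the same `Y`-neighbourhoods, and each of these contains
    -- every state.
    refine eventually_top.2 fun t => (fun A hA => ?_)
    refine mem_top.2 (Set.eq_univ_of_forall fun r => ?_)
    refine M.mem_of_mem_nhdsAt (X := Y) (s := r) ?_
    rwa [← M.nhdsAt_congr ((h' t).symm.trans (h' r))]

/-! ### Concrete models -/

/-- Every model becomes concrete upon identifying states with their assignments of values. -/
def toConcrete {Var : Type u} {Pred : Type v} {ar : Pred → ℕ}
    (M : TopoDepModel.{u, v, w, w'} Var Pred ar) : ConcreteModel.{u, v, w} Var Pred ar where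
  toTypedTopModel := M.toTypedTopModel
  states := Set.range fun s x => M.val x s
  surj := fun x d => by
    obtain ⟨s, rfl⟩ := M.surj x d
    exact ⟨_, ⟨s, rfl⟩, rfl⟩
  t0 := M.t0

/-- Truth only sees values of variables, so merging states with equal values changes nothing: the
quotient map is surjective and pulls the neighbourhood filters back to the original ones. -/
theorem sat_toConcrete {Var : Type u} {Pred : Type v} {ar : Pred → ℕ}
    (M : TopoDepModel.{u, v, w, w'} Var Pred ar) (φ : Formula Var Pred ar) (s : M.State) :
    M.toConcrete.toTopoDepModel.Sat ⟨fun x => M.val x s, s, rfl⟩ φ ↔ M.Sat s φ := by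
  set N := M.toConcrete.toTopoDepModel with hN
  let f : M.State → N.State := fun s => ⟨fun x => M.val x s, s, rfl⟩
  have hf : Function.Surjective f := by
    rintro ⟨_, s, rfl⟩
    exact ⟨s, rfl⟩
  have hj : ∀ X s, N.joint X (f s) = M.joint X s := fun _ _ => rfl
  have hn : ∀ X s, comap f (N.nhdsAt X (f s)) = M.nhdsAt X s := by
    intro X s
    rw [nhdsAt_eq_comap, nhdsAt_eq_comap, comap_comap]
    rfl
  have hev : ∀ X s (p : N.State → Prop),
      (∀ᶠ t in N.nhdsAt X (f s), p t) ↔ ∀ᶠ t in M.nhdsAt X s, p (f t) := by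
    intro X s p
    rw [← hn, ← eventually_map (m := f), map_comap_of_surjective hf]
  change N.Sat (f s) φ ↔ _
  induction φ generalizing s with
  | atom P xs => exact Iff.rfl
  | neg φ ih => rw [Sat, Sat, ih]
  | and φ ψ ih₁ ih₂ => rw [Sat, Sat, ih₁, ih₂]
  | dmod X φ ih => simp only [sat_dmod, hf.forall, hj, ih]; rfl
  | kmod X φ ih => simp only [sat_kmod, hev, ih]
  | ddep X Y => simp only [sat_ddep, hf.forall, hj]; rfl
  | kdep X Y =>
    simp only [sat_kdep, hev]
    refine eventually_congr (Eventually.of_forall fun t => ?_)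
    rw [← hn, ← hn, ← map_le_iff_le_comap, map_comap_of_surjective hf]

end TopoDepModel

open Formula

variable {Var : Type u} {Pred : Type v} {ar : Pred → ℕ}

/-! ### Relational premodels -/

/-- `S` is closed under subformulas and uses only variables from `V`. -/
structure IsClosedUnder [DecidableEq Var] (V : Finset Var) (S : Set (Formula Var Pred ar)) :
    Prop where
  atom : ∀ P xs, .atom P xs ∈ S → Finset.univ.image xs ⊆ V
  neg : ∀ φ, .neg φ ∈ S → φ ∈ S
  and : ∀ φ ψ, .and φ ψ ∈ S → φ ∈ S ∧ ψ ∈ S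
  dmod : ∀ X φ, .dmod X φ ∈ S → X ⊆ V ∧ φ ∈ S
  kmod : ∀ X φ, .kmod X φ ∈ S → X ⊆ V ∧ φ ∈ S
  ddep : ∀ X Y, .ddep X Y ∈ S → X ⊆ V ∧ Y ⊆ V
  kdep : ∀ X Y, .kdep X Y ∈ S → X ⊆ V ∧ Y ⊆ V

/-- A relational premodel for the formulas in `S` over the variables in `V`: exact equality of
`X`-values is an equivalence relation `eqv X`, closeness of `X`-values a preorder `le X`, and the
dependence statements `D_X y` and `K_X y` are primitive relations `dD` and `dK`. -/
structure Premodel [DecidableEq Var] (V : Finset Var) (S : Set (Formula Var Pred ar))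
    (W : Type*) where
  tr : W → Formula Var Pred ar → Prop
  dD : W → Finset Var → Var → Prop
  dK : W → Finset Var → Var → Prop
  eqv : Finset Var → W → W → Prop
  le : Finset Var → W → W → Prop
  eqv_refl : ∀ {X} a, X ⊆ V → eqv X a a
  eqv_symm : ∀ {X a b}, X ⊆ V → eqv X a b → eqv X b a
  eqv_trans : ∀ {X a b c}, X ⊆ V → eqv X a b → eqv X b c → eqv X a c
  eqv_le : ∀ {X a b}, X ⊆ V → eqv X a b → le X a b
  eqv_empty : ∀ a b, eqv ∅ a b
  le_trans : ∀ {X a b c}, X ⊆ V → le X a b → le X b c → le X a c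
  dD_of_mem : ∀ {X y} a, X ⊆ V → y ∈ X → dD a X y
  dD_trans : ∀ {X Y z a}, X ⊆ V → Y ⊆ V → z ∈ V → (∀ y ∈ Y, dD a X y) → dD a Y z → dD a X z
  dD_eqv : ∀ {X y a b}, X ⊆ V → y ∈ V → eqv X a b → dD a X y → dD b X y
  eqv_of_dD : ∀ {X Y a b}, X ⊆ V → Y ⊆ V → (∀ y ∈ Y, dD a X y) → eqv X a b → eqv Y a b
  dK_of_mem : ∀ {X y} a, X ⊆ V → y ∈ X → dK a X y
  dK_trans : ∀ {X Y z a}, X ⊆ V → Y ⊆ V → z ∈ V → (∀ y ∈ Y, dK a X y) → dK a Y z → dK a X z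
  dK_le : ∀ {X y a b}, X ⊆ V → y ∈ V → le X a b → dK a X y → dK b X y
  le_of_dK : ∀ {X Y a b}, X ⊆ V → Y ⊆ V → (∀ y ∈ Y, dK a X y) → le X a b → le Y a b
  dD_of_dK : ∀ {X y a}, X ⊆ V → y ∈ V → dK a X y → dD a X y
  dK_empty : ∀ {y a}, y ∈ V → dD a ∅ y → dK a ∅ y
  tr_atom : ∀ {P xs a b}, .atom P xs ∈ S → eqv (Finset.univ.image xs) a b →
    tr a (.atom P xs) → tr b (.atom P xs)
  tr_neg : ∀ {φ a}, .neg φ ∈ S → (tr a (.neg φ) ↔ ¬ tr a φ)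
  tr_and : ∀ {φ ψ a}, .and φ ψ ∈ S → (tr a (.and φ ψ) ↔ tr a φ ∧ tr a ψ)
  tr_dmod : ∀ {X φ a}, .dmod X φ ∈ S → (tr a (.dmod X φ) ↔ ∀ b, eqv X a b → tr b φ)
  tr_kmod : ∀ {X φ a}, .kmod X φ ∈ S → (tr a (.kmod X φ) ↔ ∀ b, le X a b → tr b φ)
  tr_ddep : ∀ {X Y a}, .ddep X Y ∈ S → (tr a (.ddep X Y) ↔ ∀ y ∈ Y, dD a X y)
  tr_kdep : ∀ {X Y a}, .kdep X Y ∈ S → (tr a (.kdep X Y) ↔ ∀ y ∈ Y, dK a X y)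

/-! ### Maximal consistent sets -/

theorem IsTautology.imp_iff {val : Formula Var Pred ar → Prop}
    (hn : ∀ α, val (neg α) ↔ ¬ val α) (ha : ∀ α β, val (and α β) ↔ (val α ∧ val β))
    (α β : Formula Var Pred ar) : val (imp α β) ↔ (val α → val β) := by
  simp [imp, hn, ha]

theorem IsTautology.foldr_imp_iff {val : Formula Var Pred ar → Prop}
    (hn : ∀ α, val (neg α) ↔ ¬ val α) (ha : ∀ α β, val (and α β) ↔ (val α ∧ val β))
    (L : List (Formula Var Pred ar)) (β : Formula Var Pred ar) :
    val (L.foldr imp β) ↔ ((∀ α ∈ L, val α) → val β) := by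
  induction L with
  | nil => simp
  | cons α L ih =>
    simp only [List.foldr_cons, IsTautology.imp_iff hn ha, ih, List.forall_mem_cons]
    tauto

variable [DecidableEq Var]

/-- `ψ` is derivable from the hypotheses `T`. -/
def Derivable (T : Set (Formula Var Pred ar)) (ψ : Formula Var Pred ar) : Prop :=
  ∃ L : List (Formula Var Pred ar), (∀ α ∈ L, α ∈ T) ∧ Provable (L.foldr imp ψ)

namespace Derivable

variable {T : Set (Formula Var Pred ar)} {α β ψ : Formula Var Pred ar}

theorem of_provable (h : Provable ψ) : Derivable T ψ := ⟨[], by simp, h⟩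

theorem of_mem (h : ψ ∈ T) : Derivable T ψ :=
  ⟨[ψ], by simpa using h, .taut fun val hn ha => by
    simp [IsTautology.imp_iff hn ha]⟩

theorem mp (h₁ : Derivable T (imp α β)) (h₂ : Derivable T α) : Derivable T β := by
  obtain ⟨L₁, hL₁, h₁⟩ := h₁
  obtain ⟨L₂, hL₂, h₂⟩ := h₂
  refine ⟨L₁ ++ L₂, fun a ha => (List.mem_append.1 ha).elim (hL₁ a) (hL₂ a), ?_⟩
  refine .modusPonens (.modusPonens (.taut fun val hn ha => ?_) h₁) h₂
  simp only [IsTautology.imp_iff hn ha, IsTautology.foldr_imp_iff hn ha, List.mem_append]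
  exact fun h₁ h₂ h => h₁ (fun a m => h a (.inl m)) (h₂ fun a m => h a (.inr m))

theorem deduction (h : Derivable (insert α T) β) : Derivable T (imp α β) := by
  classical
  obtain ⟨L, hL, h⟩ := h
  refine ⟨L.filter (· ≠ α), fun a ha => ?_, .modusPonens (.taut fun val hn ha => ?_) h⟩
  · simp only [ne_eq, decide_not, List.mem_filter, Bool.not_eq_eq_eq_not, Bool.not_true,
      decide_eq_false_iff_not] at ha
    exact (hL a ha.1).resolve_left ha.2
  · simp only [IsTautology.imp_iff hn ha, IsTautology.foldr_imp_iff hn ha]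
    intro h₁ h₂ h₃
    refine h₁ fun a m => ?_
    by_cases e : a = α
    · exact e ▸ h₃
    · exact h₂ a (by simp [m, e])

end Derivable

/-- Maximal consistent sets, described as valuations that make all theorems true. -/
structure IsMCS (Γ : Set (Formula Var Pred ar)) : Prop where
  neg : ∀ α, neg α ∈ Γ ↔ α ∉ Γ
  and : ∀ α β, Formula.and α β ∈ Γ ↔ α ∈ Γ ∧ β ∈ Γ
  prov : ∀ {α}, Provable α → α ∈ Γ

theorem IsMCS.imp {Γ : Set (Formula Var Pred ar)} (h : IsMCS Γ) (α β : Formula Var Pred ar) :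
    imp α β ∈ Γ ↔ (α ∈ Γ → β ∈ Γ) :=
  IsTautology.imp_iff (val := (· ∈ Γ)) h.neg h.and α β

theorem IsMCS.mp {Γ : Set (Formula Var Pred ar)} (h : IsMCS Γ) {α β : Formula Var Pred ar}
    (hp : Provable (.imp α β)) (hα : α ∈ Γ) : β ∈ Γ :=
  (h.imp α β).1 (h.prov hp) hα

/-- A set maximal among those that do not derive `ψ` decides every formula: if `α` and `¬α` were
both missing, both would imply `ψ`. -/
theorem exists_isMCS {T : Set (Formula Var Pred ar)} {ψ : Formula Var Pred ar}
    (h : ¬ Derivable T ψ) : ∃ Γ, IsMCS Γ ∧ T ⊆ Γ ∧ ψ ∉ Γ := by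
  obtain ⟨Γ, hTΓ, hΓ⟩ := zorn_subset_nonempty {T | ¬ Derivable T ψ} (by
    intro c hc hcc hne
    refine ⟨⋃₀ c, ?_, fun s hs => Set.subset_sUnion_of_mem hs⟩
    rintro ⟨L, hL, hp⟩
    -- A derivation uses finitely many hypotheses, so one member of the chain contains them all.
    have hfin : ({a | a ∈ L} : Set (Formula Var Pred ar)).Finite := L.finite_toSet
    obtain ⟨t, htc, ht⟩ := DirectedOn.exists_mem_subset_of_finite_of_subset_sUnion hne
      hcc.directedOn hfin (fun a ha => hL a ha)
    exact hc htc ⟨L, ht, hp⟩) T h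
  have hmax : ∀ α, α ∉ Γ → Derivable Γ (.imp α ψ) := by
    intro α hα
    by_contra hd
    have : ¬ Derivable (insert α Γ) ψ := fun h' => hd h'.deduction
    exact hα (hΓ.2 this (Set.subset_insert _ _) (Set.mem_insert _ _))
  have hcl : ∀ {α}, Derivable Γ α → α ∈ Γ := by
    intro α hα
    by_contra hn
    exact hΓ.1 ((hmax α hn).mp hα)
  refine ⟨Γ, ⟨fun α => ⟨fun h₁ h₂ => ?_, fun h₁ => ?_⟩, fun α β => ⟨fun h => ⟨?_, ?_⟩, ?_⟩,
    fun hp => hcl (.of_provable hp)⟩, hTΓ, fun h' => hΓ.1 (.of_mem h')⟩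
  · refine hΓ.1 (.mp (.mp (.of_provable (.taut fun val hn ha => ?_)) (.of_mem h₁)) (.of_mem h₂))
    simp only [IsTautology.imp_iff hn ha, hn]
    tauto
  · by_contra h₂
    refine hΓ.1 (.mp (.mp (.of_provable (.taut fun val hn ha => ?_)) (hmax _ h₁)) (hmax _ h₂))
    simp only [IsTautology.imp_iff hn ha, hn]
    tauto
  · refine hcl (.mp (.of_provable (.taut fun val hn ha => ?_)) (.of_mem h))
    simp only [IsTautology.imp_iff hn ha, ha]
    tauto
  · refine hcl (.mp (.of_provable (.taut fun val hn ha => ?_)) (.of_mem h))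
    simp only [IsTautology.imp_iff hn ha, ha]
    tauto
  · rintro ⟨h₁, h₂⟩
    refine hcl (.mp (.mp (.of_provable (.taut fun val hn ha => ?_)) (.of_mem h₁)) (.of_mem h₂))
    simp only [IsTautology.imp_iff hn ha, ha]
    tauto

/-- The existence lemma for a normal modality. -/
theorem IsMCS.exists_successor {Γ : Set (Formula Var Pred ar)} (hΓ : IsMCS Γ)
    (box : Formula Var Pred ar → Formula Var Pred ar)
    (nec : ∀ {α}, Provable α → Provable (box α))
    (dist : ∀ α β, Provable (.imp (box (.imp α β)) (.imp (box α) (box β))))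
    {ψ : Formula Var Pred ar} (h : box ψ ∉ Γ) :
    ∃ Δ, IsMCS Δ ∧ (∀ α, box α ∈ Γ → α ∈ Δ) ∧ ψ ∉ Δ := by
  have : ¬ Derivable {α | box α ∈ Γ} ψ := by
    rintro ⟨L, hL, hp⟩
    have key : ∀ L : List (Formula Var Pred ar), (∀ α ∈ L, box α ∈ Γ) →
        box (L.foldr Formula.imp ψ) ∈ Γ → box ψ ∈ Γ := by
      intro L
      induction L with
      | nil => exact fun _ h => h
      | cons α L ih =>
        intro hL hm
        rw [List.forall_mem_cons] at hL
        exact ih hL.2 ((hΓ.imp _ _).1 (hΓ.mp (dist _ _) hm) hL.1)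
    exact h (key L hL (hΓ.prov (nec hp)))
  obtain ⟨Δ, hΔ, hsub, hψ⟩ := exists_isMCS this
  exact ⟨Δ, hΔ, fun α hα => hsub hα, hψ⟩

theorem exists_isMCS_notMem {φ : Formula Var Pred ar} (h : ¬ Provable φ) :
    ∃ Γ, IsMCS Γ ∧ φ ∉ Γ := by
  obtain ⟨Γ, hΓ, -, hφ⟩ := exists_isMCS (T := ∅) (ψ := φ) (by
    rintro ⟨L, hL, hp⟩
    obtain rfl : L = [] := List.eq_nil_iff_forall_not_mem.2 hL
    exact h hp)
  exact ⟨Γ, hΓ, hφ⟩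

/-! ### Determined and knowable formulas -/

/-- `α` is provably determined by the variables in `Z`. -/
def Determined (Z : Finset Var) (α : Formula Var Pred ar) : Prop := Provable (imp α (dmod Z α))

/-- `α` is provably knowable from the variables in `Z`. -/
def Knowable (Z : Finset Var) (α : Formula Var Pred ar) : Prop := Provable (imp α (kmod Z α))

theorem Provable.imp_trans {α β γ : Formula Var Pred ar} (h₁ : Provable (imp α β))
    (h₂ : Provable (imp β γ)) : Provable (imp α γ) :=
  .modusPonens (.modusPonens (.taut fun val hn ha => by
    simp only [IsTautology.imp_iff hn ha]; tauto) h₁) h₂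

theorem Provable.contrapose {α β : Formula Var Pred ar} (h : Provable (imp α β)) :
    Provable (imp (neg β) (neg α)) :=
  .modusPonens (.taut fun val hn ha => by
    simp only [IsTautology.imp_iff hn ha, hn]; tauto) h

theorem Knowable.determined {Z : Finset Var} {α : Formula Var Pred ar} (h : Knowable Z α) :
    Determined Z α :=
  h.imp_trans (.knowableDetermination Z α)

/-- Negative introspection for `D_Z` makes determinacy symmetric under negation, the source of the
symmetry of `CanonEqv`. Nothing similar holds for `K_Z`, hence the one-sided `CanonLe`. -/
theorem Determined.neg {Z : Finset Var} {α : Formula Var Pred ar} (h : Determined Z α) :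
    Determined Z (neg α) :=
  ((Provable.dT Z α).contrapose.imp_trans (.d5 Z α)).imp_trans
    (.modusPonens (.dDist Z _ _) (.dNec Z h.contrapose))

namespace IsMCS

variable {Γ : Set (Formula Var Pred ar)}

theorem ddep_iff (hΓ : IsMCS Γ) {X Y : Finset Var} : ddep X Y ∈ Γ ↔ ∀ y ∈ Y, ddep X {y} ∈ Γ := by
  constructor
  · intro h y hy
    exact hΓ.mp (.dTrans X Y {y}) ((hΓ.and _ _).2 ⟨h, hΓ.prov (.dIncl _ _ (by simpa using hy))⟩)
  · induction Y using Finset.induction_on with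
    | empty => exact fun _ => hΓ.prov (.dIncl _ _ (Finset.empty_subset _))
    | insert y Y _ ih =>
      intro h
      rw [Finset.insert_eq]
      exact hΓ.mp (.dAdd _ _ _) ((hΓ.and _ _).2
        ⟨h y (by simp), ih fun z hz => h z (by simp [hz])⟩)

theorem kdep_iff (hΓ : IsMCS Γ) {X Y : Finset Var} : kdep X Y ∈ Γ ↔ ∀ y ∈ Y, kdep X {y} ∈ Γ := by
  constructor
  · intro h y hy
    exact hΓ.mp (.kTrans X Y {y}) ((hΓ.and _ _).2 ⟨h, hΓ.prov (.kIncl _ _ (by simpa using hy))⟩)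
  · induction Y using Finset.induction_on with
    | empty => exact fun _ => hΓ.prov (.kIncl _ _ (Finset.empty_subset _))
    | insert y Y _ ih =>
      intro h
      rw [Finset.insert_eq]
      exact hΓ.mp (.kAdd _ _ _) ((hΓ.and _ _).2
        ⟨h y (by simp), ih fun z hz => h z (by simp [hz])⟩)

theorem ddep_trans (hΓ : IsMCS Γ) {X Y Z : Finset Var} (h₁ : ddep X Y ∈ Γ) (h₂ : ddep Y Z ∈ Γ) :
    ddep X Z ∈ Γ :=
  hΓ.mp (.dTrans X Y Z) ((hΓ.and _ _).2 ⟨h₁, h₂⟩)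

theorem kdep_trans (hΓ : IsMCS Γ) {X Y Z : Finset Var} (h₁ : kdep X Y ∈ Γ) (h₂ : kdep Y Z ∈ Γ) :
    kdep X Z ∈ Γ :=
  hΓ.mp (.kTrans X Y Z) ((hΓ.and _ _).2 ⟨h₁, h₂⟩)

theorem dmod_of_ddep (hΓ : IsMCS Γ) {X Z : Finset Var} {α : Formula Var Pred ar} (h : ddep X Z ∈ Γ)
    (hα : dmod Z α ∈ Γ) : dmod X α ∈ Γ :=
  (hΓ.imp _ _).1 (hΓ.mp (.dTransfer X Z α) h) hα

theorem kmod_of_kdep (hΓ : IsMCS Γ) {X Z : Finset Var} {α : Formula Var Pred ar} (h : kdep X Z ∈ Γ)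
    (hα : kmod Z α ∈ Γ) : kmod X α ∈ Γ :=
  (hΓ.imp _ _).1 (hΓ.mp (.kTransfer X Z α) h) hα

end IsMCS

variable {Var : Type u} {Pred : Type v} {ar : Pred → ℕ}

/-! ### The filtrated canonical premodel -/

/-- The formulas in `S`, together with the dependence statements over `V`. -/
def filtrationSet (V : Finset Var) (S : Set (Formula Var Pred ar)) : Set (Formula Var Pred ar) :=
  S ∪ {α | ∃ X ⊆ V, ∃ y ∈ V, α = ddep X {y} ∨ α = kdep X {y}}

theorem ddep_mem_filtrationSet {V : Finset Var} {S : Set (Formula Var Pred ar)} {X : Finset Var}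
    {y : Var} (hX : X ⊆ V) (hy : y ∈ V) : ddep X {y} ∈ filtrationSet V S :=
  .inr ⟨X, hX, y, hy, .inl rfl⟩

theorem kdep_mem_filtrationSet {V : Finset Var} {S : Set (Formula Var Pred ar)} {X : Finset Var}
    {y : Var} (hX : X ⊆ V) (hy : y ∈ V) : kdep X {y} ∈ filtrationSet V S :=
  .inr ⟨X, hX, y, hy, .inr rfl⟩

variable [DecidableEq Var]

/-- Agreement on the formulas of `Φ` determined by what `X` determines. -/
def CanonEqv (V : Finset Var) (Φ : Set (Formula Var Pred ar)) (X : Finset Var)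
    (Γ Δ : Set (Formula Var Pred ar)) : Prop :=
  ∀ Z ⊆ V, ddep X Z ∈ Γ → ∀ α ∈ Φ, Determined Z α → (α ∈ Γ ↔ α ∈ Δ)

/-- Preservation of the formulas of `Φ` knowable from what is knowably determined by `X`. -/
def CanonLe (V : Finset Var) (Φ : Set (Formula Var Pred ar)) (X : Finset Var)
    (Γ Δ : Set (Formula Var Pred ar)) : Prop :=
  ∀ Z ⊆ V, kdep X Z ∈ Γ → ∀ α ∈ Φ, Knowable Z α → α ∈ Γ → α ∈ Δ

/-! ### Laws of the canonical equality and closeness relations. -/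

section Canonical

variable {V X Y : Finset Var} {S : Set (Formula Var Pred ar)} {Γ Δ Θ : Set (Formula Var Pred ar)}

/-- Applied to a determined formula or to its negation, the successor condition gives agreement both
ways. Thus genuine canonical successors are related by `CanonEqv`. -/
theorem IsMCS.mem_iff_of_dmod (hΓ : IsMCS Γ) (hΔ : IsMCS Δ)
    (h : ∀ α, dmod X α ∈ Γ → α ∈ Δ) {Z : Finset Var} (hZ : ddep X Z ∈ Γ)
    {α : Formula Var Pred ar} (hα : Determined Z α) : α ∈ Γ ↔ α ∈ Δ := by
  refine ⟨fun hm => h _ (hΓ.dmod_of_ddep hZ (hΓ.mp hα hm)), fun hm => ?_⟩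
  by_contra hn
  have h₁ := h _ (hΓ.dmod_of_ddep hZ (hΓ.mp hα.neg ((hΓ.neg α).2 hn)))
  exact (hΔ.neg α).1 h₁ hm

theorem CanonEqv.mem_iff (h : CanonEqv V (filtrationSet V S) X Γ Δ) (hΓ : IsMCS Γ) (hX : X ⊆ V)
    {α : Formula Var Pred ar} (hα : α ∈ filtrationSet V S) (hd : Determined X α) :
    α ∈ Γ ↔ α ∈ Δ :=
  h X hX (hΓ.prov (.dIncl _ _ subset_rfl)) α hα hd

/-- `CanonEqv` quantifies over the sets that depend on `X` in `Γ` only. Dependence statements are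
themselves determined by `X` and belong to the filtration set, so the same sets are available in
`Δ`; symmetry and transitivity follow. -/
theorem CanonEqv.ddep_iff (h : CanonEqv V (filtrationSet V S) X Γ Δ) (hΓ : IsMCS Γ)
    (hΔ : IsMCS Δ) (hX : X ⊆ V) (hY : Y ⊆ V) : ddep X Y ∈ Γ ↔ ddep X Y ∈ Δ := by
  rw [hΓ.ddep_iff, hΔ.ddep_iff]
  exact forall₂_congr fun y hy =>
    h.mem_iff hΓ hX (ddep_mem_filtrationSet hX (hY hy)) (.determinedDep X {y})

theorem CanonEqv.symm (h : CanonEqv V (filtrationSet V S) X Γ Δ) (hΓ : IsMCS Γ) (hΔ : IsMCS Δ)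
    (hX : X ⊆ V) : CanonEqv V (filtrationSet V S) X Δ Γ :=
  fun Z hZV hZ α hα hd => (h Z hZV ((h.ddep_iff hΓ hΔ hX hZV).2 hZ) α hα hd).symm

theorem CanonEqv.trans (h₁ : CanonEqv V (filtrationSet V S) X Γ Δ)
    (h₂ : CanonEqv V (filtrationSet V S) X Δ Θ) (hΓ : IsMCS Γ) (hΔ : IsMCS Δ) (hX : X ⊆ V) :
    CanonEqv V (filtrationSet V S) X Γ Θ :=
  fun Z hZV hZ α hα hd => (h₁ Z hZV hZ α hα hd).trans
    (h₂ Z hZV ((h₁.ddep_iff hΓ hΔ hX hZV).1 hZ) α hα hd)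

theorem CanonEqv.canonLe (h : CanonEqv V (filtrationSet V S) X Γ Δ) (hΓ : IsMCS Γ) :
    CanonLe V (filtrationSet V S) X Γ Δ :=
  fun Z hZV hZ α hα hk => (h Z hZV (hΓ.mp (.knowableDependence X Z) hZ) α hα hk.determined).1

theorem CanonEqv.of_ddep (h : CanonEqv V (filtrationSet V S) X Γ Δ) (hΓ : IsMCS Γ)
    (hXY : ddep X Y ∈ Γ) : CanonEqv V (filtrationSet V S) Y Γ Δ :=
  fun Z hZV hZ => h Z hZV (hΓ.ddep_trans hXY hZ)

theorem CanonLe.mem (h : CanonLe V (filtrationSet V S) X Γ Δ) (hΓ : IsMCS Γ) (hX : X ⊆ V)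
    {α : Formula Var Pred ar} (hα : α ∈ filtrationSet V S) (hk : Knowable X α) (hm : α ∈ Γ) :
    α ∈ Δ :=
  h X hX (hΓ.prov (.kIncl _ _ subset_rfl)) α hα hk hm

theorem CanonLe.kdep_mem (h : CanonLe V (filtrationSet V S) X Γ Δ) (hΓ : IsMCS Γ)
    (hΔ : IsMCS Δ) (hX : X ⊆ V) (hY : Y ⊆ V) (hXY : kdep X Y ∈ Γ) : kdep X Y ∈ Δ := by
  rw [hΔ.kdep_iff]
  rw [hΓ.kdep_iff] at hXY
  exact fun y hy => h.mem hΓ hX (kdep_mem_filtrationSet hX (hY hy)) (.knowabilityOfDep X {y})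
    (hXY y hy)

theorem CanonLe.trans (h₁ : CanonLe V (filtrationSet V S) X Γ Δ)
    (h₂ : CanonLe V (filtrationSet V S) X Δ Θ) (hΓ : IsMCS Γ) (hΔ : IsMCS Δ) (hX : X ⊆ V) :
    CanonLe V (filtrationSet V S) X Γ Θ :=
  fun Z hZV hZ α hα hk hm => h₂ Z hZV (h₁.kdep_mem hΓ hΔ hX hZV hZ) α hα hk
    (h₁ Z hZV hZ α hα hk hm)

theorem CanonLe.of_kdep (h : CanonLe V (filtrationSet V S) X Γ Δ) (hΓ : IsMCS Γ)
    (hXY : kdep X Y ∈ Γ) : CanonLe V (filtrationSet V S) Y Γ Δ :=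
  fun Z hZV hZ => h Z hZV (hΓ.kdep_trans hXY hZ)

end Canonical

/-- The canonical premodel over a family of maximal consistent sets that represents, up to the
formulas of the filtration set, all maximal consistent sets with the same global facts. -/
def canonicalPremodel {V : Finset Var} {S : Set (Formula Var Pred ar)} (hS : IsClosedUnder V S)
    {W : Type*} (g : W → Set (Formula Var Pred ar)) (hg : ∀ a, IsMCS (g a))
    (huniv : ∀ a b α, dmod ∅ α ∈ g a → α ∈ g b)
    (hdense : ∀ a Δ, IsMCS Δ → (∀ α, dmod ∅ α ∈ g a → α ∈ Δ) →
      ∃ b, ∀ α ∈ filtrationSet V S, α ∈ Δ ↔ α ∈ g b) :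
    Premodel V S W where
  tr a α := α ∈ g a
  dD a X y := ddep X {y} ∈ g a
  dK a X y := kdep X {y} ∈ g a
  eqv X a b := CanonEqv V (filtrationSet V S) X (g a) (g b)
  le X a b := CanonLe V (filtrationSet V S) X (g a) (g b)
  eqv_refl _ _ _ _ _ _ _ _ := Iff.rfl
  eqv_symm hX h := h.symm (hg _) (hg _) hX
  eqv_trans hX h₁ h₂ := h₁.trans h₂ (hg _) (hg _) hX
  eqv_le _ h := h.canonLe (hg _)
  eqv_empty a b _ _ hZ _ _ hd := (hg a).mem_iff_of_dmod (hg b) (huniv a b) hZ hd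
  le_trans hX h₁ h₂ := h₁.trans h₂ (hg _) (hg _) hX
  dD_of_mem a _ hy := (hg a).prov (.dIncl _ _ (by simpa using hy))
  dD_trans _ _ _ h₁ h₂ := (hg _).ddep_trans ((hg _).ddep_iff.2 h₁) h₂
  dD_eqv hX hy h h₁ := (h.ddep_iff (hg _) (hg _) hX (by simpa using hy)).1 h₁
  eqv_of_dD _ _ h₁ h := h.of_ddep (hg _) ((hg _).ddep_iff.2 h₁)
  dK_of_mem a _ hy := (hg a).prov (.kIncl _ _ (by simpa using hy))
  dK_trans _ _ _ h₁ h₂ := (hg _).kdep_trans ((hg _).kdep_iff.2 h₁) h₂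
  dK_le hX hy h h₁ := h.kdep_mem (hg _) (hg _) hX (by simpa using hy) h₁
  le_of_dK _ _ h₁ h := h.of_kdep (hg _) ((hg _).kdep_iff.2 h₁)
  dD_of_dK _ _ h := (hg _).mp (.knowableDependence _ _) h
  dK_empty _ h := (hg _).mp (.knowledgeOfConstants _) h
  tr_atom hm h := (h.mem_iff (hg _) (hS.atom _ _ hm) (.inl hm) (.determinedAtoms _ _)).1
  tr_neg _ := (hg _).neg _
  tr_and _ := (hg _).and _ _
  -- `D_X φ` is determined by `X` through axiom 4, so it passes to equivalent states. For the
  -- converse, a successor without `φ` is replaced by its representative, which agrees with it on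
  -- the filtration set.
  tr_dmod {X φ a} hm := by
    refine ⟨fun h b hb => ?_, fun h => ?_⟩
    · exact (hg b).mp (.dT X φ) ((hb.mem_iff (hg a) (hS.dmod _ _ hm).1 (.inl hm) (.d4 X φ)).1 h)
    · by_contra hn
      obtain ⟨Δ, hΔ, hΔX, hφ⟩ := (hg a).exists_successor (dmod X) (.dNec X) (.dDist X) hn
      obtain ⟨b, hb⟩ := hdense a Δ hΔ fun α hα =>
        hΔX α ((hg a).dmod_of_ddep ((hg a).prov (.dIncl _ _ (Finset.empty_subset X))) hα)
      refine hφ ((hb φ (.inl (hS.dmod _ _ hm).2)).2 (h b ?_))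
      intro Z hZV hZ α hα hd
      rw [← hb α hα]
      exact (hg a).mem_iff_of_dmod hΔ hΔX hZ hd
  tr_kmod {X φ a} hm := by
    refine ⟨fun h b hb => ?_, fun h => ?_⟩
    · exact (hg b).mp (.veracity X φ)
        (hb.mem (hg a) (hS.kmod _ _ hm).1 (.inl hm) (.posIntro X φ) h)
    · by_contra hn
      obtain ⟨Δ, hΔ, hΔX, hφ⟩ := (hg a).exists_successor (kmod X) (.kNec X) (.kDist X) hn
      -- A `K_X`-successor has the same global facts because `D_∅ α` implies `K_∅ α`, which implies
      -- `K_X α`.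
      obtain ⟨b, hb⟩ := hdense a Δ hΔ fun α hα => hΔX α
        ((hg a).kmod_of_kdep ((hg a).prov (.kIncl _ _ (Finset.empty_subset X)))
          ((hg a).mp (.knowledgeOfNecessity α) hα))
      refine hφ ((hb φ (.inl (hS.kmod _ _ hm).2)).2 (h b ?_))
      intro Z hZV hZ α hα hk hαa
      rw [← hb α hα]
      exact hΔX α ((hg a).kmod_of_kdep hZ ((hg a).mp hk hαa))
  tr_ddep _ := (hg _).ddep_iff
  tr_kdep _ := (hg _).kdep_iff

/-- An unprovable formula is refuted in a premodel of bounded finite size. -/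
theorem exists_premodel {V : Finset Var} {S : Set (Formula Var Pred ar)} (hS : IsClosedUnder V S)
    (Φ : Finset (Formula Var Pred ar)) (hΦ : filtrationSet V S ⊆ Φ) {N : ℕ}
    (hN : 2 ^ Φ.card ≤ N) {φ : Formula Var Pred ar} (hφS : φ ∈ S) (hφ : ¬ Provable φ) :
    ∃ (M : Premodel V S (Fin N)) (a : Fin N), ¬ M.tr a φ := by
  classical
  obtain ⟨Γ₀, hΓ₀, hφ₀⟩ := exists_isMCS_notMem hφ
  -- Sharing the `D_∅`-facts of `Γ₀` makes any two states equal for the empty set of variables.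
  let C : Type _ := {Γ : Set (Formula Var Pred ar) // IsMCS Γ ∧ ∀ α, dmod ∅ α ∈ Γ₀ → α ∈ Γ}
  let r : C → Φ.powerset := fun Γ =>
    ⟨Φ.filter (· ∈ Γ.1), Finset.mem_powerset.2 (Finset.filter_subset _ _)⟩
  let γ₀ : C := ⟨Γ₀, hΓ₀, fun α => hΓ₀.mp (.dT ∅ α)⟩
  -- A surjection suffices: repeated representatives pad the premodel to exactly `N` states.
  obtain ⟨f, hf⟩ : ∃ f : Fin N → Set.range r, Function.Surjective f := by
    have : Nonempty (Set.range r) := ⟨⟨r γ₀, γ₀, rfl⟩⟩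
    have hcard : Fintype.card (Set.range r) ≤ Fintype.card (Fin N) := by
      refine (Fintype.card_le_of_injective _ Subtype.val_injective).trans ?_
      simpa using hN
    obtain ⟨e⟩ := Function.Embedding.nonempty_of_card_le hcard
    exact ⟨Function.invFun e, Function.invFun_surjective e.injective⟩
  choose c hc using fun i => (f i).2
  have hrep : ∀ Γ : C, ∃ i, ∀ α ∈ filtrationSet V S, α ∈ Γ.1 ↔ α ∈ (c i).1 := by
    intro Γ
    obtain ⟨i, hi⟩ := hf ⟨r Γ, Γ, rfl⟩
    refine ⟨i, fun α hα => ?_⟩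
    have h₁ : r (c i) = r Γ := by rw [hc i, hi]
    have h₂ := Finset.ext_iff.1 (congrArg Subtype.val h₁) α
    simp only [r, Finset.mem_filter, show α ∈ Φ from hΦ hα, true_and] at h₂
    exact h₂.symm
  let M : Premodel V S (Fin N) := canonicalPremodel hS (fun i => (c i).1) (fun i => (c i).2.1)
    (fun i j α hα => by
      refine (c j).2.2 α ?_
      by_contra hn
      exact ((c i).2.1.neg _).1
        ((c i).2.2 _ (hΓ₀.mp (.d5 ∅ α) ((hΓ₀.neg _).2 hn))) hα)
    (fun i Δ hΔ hiΔ => hrep ⟨Δ, hΔ, fun α hα =>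
      hiΔ α ((c i).2.2 _ (hΓ₀.mp (.d4 ∅ α) hα))⟩)
  obtain ⟨i, hi⟩ := hrep γ₀
  exact ⟨M, i, fun h => hφ₀ ((hi φ (.inl hφS)).2 h)⟩

/-! ### Ultrametrics on trees of histories

A history is a list, its most recent entry first; the nonempty suffixes of a history are the edges
between the history and the root. -/

section Tree

open scoped symmDiff Classical in
/-- The edges between two histories. -/
noncomputable def treePath {α : Type*} (h h' : List α) : Finset (List α) :=
  h.tails.toFinset ∆ h'.tails.toFinset

variable {α : Type*} {h h' h'' a g : List α} {s : α}

theorem mem_treePath : a ∈ treePath h h' ↔ (a <:+ h ∧ ¬ a <:+ h') ∨ (a <:+ h' ∧ ¬ a <:+ h) := by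
  classical
  simp [treePath, Finset.mem_symmDiff]

theorem treePath_self : treePath h h = ∅ := by
  ext a
  simp [mem_treePath]

theorem treePath_comm : treePath h h' = treePath h' h := by
  ext a
  simp only [mem_treePath]
  tauto

theorem mem_treePath_triangle (ha : a ∈ treePath h h'') :
    a ∈ treePath h h' ∨ a ∈ treePath h' h'' := by
  simp only [mem_treePath] at *
  tauto

theorem mem_treePath_cons : a ∈ treePath h (s :: h) ↔ a = s :: h := by
  rw [mem_treePath]
  constructor
  · rintro (⟨h₁, h₂⟩ | ⟨h₁, h₂⟩)
    · exact absurd (h₁.trans (List.suffix_cons s h)) h₂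
    · exact (List.suffix_cons_iff.1 h₁).resolve_right h₂
  · rintro rfl
    refine .inr ⟨List.suffix_rfl, fun h₁ => ?_⟩
    have := h₁.length_le
    simp at this

theorem ne_nil_of_mem_treePath (ha : a ∈ treePath h h') : a ≠ [] := by
  rintro rfl
  simp [mem_treePath] at ha

/-- Suffixes of one list are comparable, so the stretch from `h` to the root-side end of an edge of
the path stays on the path. This permits transporting facts from `h` to the start of each edge in
turn. -/
theorem treePath_subset_of_mem (ha : s :: g ∈ treePath h h') : treePath h g ⊆ treePath h h' := by
  have key : ∀ {b k : List α}, b <:+ k → s :: g <:+ k → ¬ b <:+ g → s :: g <:+ b := by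
    intro b k h₁ h₂ h₃
    rcases List.suffix_or_suffix_of_suffix h₁ h₂ with h₄ | h₄
    · rcases List.suffix_cons_iff.1 h₄ with rfl | h₅
      · exact List.suffix_rfl
      · exact absurd h₅ h₃
    · exact h₄
  intro b hb
  rw [mem_treePath] at *
  rcases ha with ⟨h₁, h₂⟩ | ⟨h₁, h₂⟩
  · have hg : g <:+ h := (List.suffix_cons s g).trans h₁
    rcases hb with ⟨h₃, h₄⟩ | ⟨h₃, h₄⟩
    · exact .inl ⟨h₃, fun h₅ => h₂ ((key h₃ h₁ h₄).trans h₅)⟩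
    · exact absurd (h₃.trans hg) h₄
  · have hg : g <:+ h' := (List.suffix_cons s g).trans h₁
    rcases hb with ⟨h₃, h₄⟩ | ⟨h₃, h₄⟩
    · exact .inl ⟨h₃, fun h₅ => h₂ ((key h₅ h₁ h₄).trans h₃)⟩
    · exact .inr ⟨h₃.trans hg, h₄⟩

/-- A preorder that holds along all edges of a path, upwards from `h` and downwards to `h'`, holds
between its end points. -/
theorem rel_of_treePath {β : Type*} (last : List α → β) {R : β → β → Prop} (hrefl : ∀ b, R b b)
    (htrans : ∀ {a b c}, R a b → R b c → R a c)
    (hup : ∀ s g, s :: g <:+ h → s :: g ∈ treePath h h' → R (last (s :: g)) (last g))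
    (hdown : ∀ s g, s :: g <:+ h' → s :: g ∈ treePath h h' → R (last g) (last (s :: g))) :
    R (last h) (last h') := by
  have hsuf : ∀ {k c}, c <:+ k → (∀ s g, s :: g <:+ k → s :: g ∈ treePath k c →
      R (last (s :: g)) (last g)) → R (last k) (last c) := by
    clear hup hdown
    rintro k c ⟨p, rfl⟩ hup
    induction p with
    | nil => exact hrefl _
    | cons s p ih =>
      have hlt : ∀ {b : List α}, (p ++ c).length < b.length → ¬ b <:+ c := fun hb h₁ => by
        have := h₁.length_le
        simp at hb
        omega
      refine htrans (hup s (p ++ c) List.suffix_rfl ?_) (ih fun t g h₁ h₂ => hup t g ?_ ?_)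
      · exact mem_treePath.2 (.inl ⟨List.suffix_rfl, hlt (by simp)⟩)
      · exact h₁.trans (List.suffix_cons s _)
      · rw [mem_treePath] at h₂ ⊢
        refine .inl ⟨h₁.trans (List.suffix_cons s _), ?_⟩
        rcases h₂ with h₂ | h₂
        · exact h₂.2
        · exact absurd (h₂.1.trans (List.suffix_append p c)) h₂.2
  by_cases hs : h' <:+ h
  · exact hsuf hs hup
  -- Since `h'` is not above `h`, the last edge of the path enters `h'` downwards; it is peeled off.
  induction h' with
  | nil => exact absurd (List.nil_suffix) hs
  | cons s g ih =>
    have hmem : s :: g ∈ treePath h (s :: g) := mem_treePath.2 (.inr ⟨List.suffix_rfl, hs⟩)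
    have hsub := treePath_subset_of_mem hmem
    refine htrans ?_ (hdown s g List.suffix_rfl hmem)
    by_cases hg : g <:+ h
    · exact hsuf hg fun t k h₁ h₂ => hup t k h₁ (hsub h₂)
    · exact ih (fun t k h₁ h₂ => hup t k h₁ (hsub h₂))
        (fun t k h₁ h₂ => hdown t k (h₁.trans (List.suffix_cons s g)) (hsub h₂)) hg

/-- The ultrametric given by the maximal length of an edge on the path between two histories. -/
noncomputable def treeDist (len : List α → NNReal) (h h' : List α) : NNReal :=
  (treePath h h').sup len

variable {len : List α → NNReal}

theorem treeDist_self : treeDist len h h = 0 := by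
  simp [treeDist, treePath_self]

theorem treeDist_comm : treeDist len h h' = treeDist len h' h := by
  rw [treeDist, treePath_comm, treeDist]

theorem treeDist_triangle : treeDist len h h'' ≤ max (treeDist len h h') (treeDist len h' h'') :=
  Finset.sup_le fun _ ha => (mem_treePath_triangle ha).elim
    (fun h₁ => le_max_of_le_left (Finset.le_sup h₁))
    (fun h₁ => le_max_of_le_right (Finset.le_sup h₁))

theorem treeDist_cons : treeDist len h (s :: h) = len (s :: h) := by
  have : treePath h (s :: h) = {s :: h} := by
    ext a
    rw [mem_treePath_cons, Finset.mem_singleton]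
  rw [treeDist, this, Finset.sup_singleton]

theorem le_treeDist (ha : a ∈ treePath h h') : len a ≤ treeDist len h h' := Finset.le_sup ha

theorem treeDist_le {c : NNReal} (hc : ∀ a ∈ treePath h h', len a ≤ c) : treeDist len h h' ≤ c :=
  Finset.sup_le hc

theorem treeDist_le_of_mem (ha : s :: g ∈ treePath h h') : treeDist len h g ≤ treeDist len h h' :=
  Finset.sup_mono (treePath_subset_of_mem ha)

end Tree

/-! ### Histories in a premodel -/

/-- A step of a history: the index of a set of variables, the kind of the step (`none` for exact
equality, `some e` for closeness up to `1 / (e + 2)`), and the state it leads to. -/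
abbrev Step (W : Type*) := ℕ × Option ℕ × W

/-- The last state of a history that starts at `a₀`. -/
def lastState {W : Type*} (a₀ : W) : List (Step W) → W
  | [] => a₀
  | s :: _ => s.2.2

namespace Premodel

variable {Var : Type u} {Pred : Type v} {ar : Pred → ℕ} [DecidableEq Var]
  {V : Finset Var} {S : Set (Formula Var Pred ar)} {W : Type*}
  (M : Premodel V S W) (lab : ℕ → Finset Var) (a₀ : W)

/-- Every step of the history follows the relation of its kind. -/
def IsHistory : List (Step W) → Prop
  | [] => True
  | (n, none, b) :: h => IsHistory h ∧ M.eqv (lab n) (lastState a₀ h) b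
  | (n, some _, b) :: h => IsHistory h ∧ M.le (lab n) (lastState a₀ h) b

open scoped Classical in
/-- The length of an edge as seen by the variable `x`. -/
noncomputable def edgeLen (x : Var) : List (Step W) → NNReal
  | [] => 0
  | (n, none, _) :: h => if x ∈ V → M.dD (lastState a₀ h) (lab n) x then 0 else 1
  | (n, some e, _) :: h =>
      -- Only constants and variables outside `V` see no movement. With `e + 2` the length is below
      -- 1, so that length 1 signals the absence of knowable dependence.
      if x ∈ V → M.dD (lastState a₀ h) ∅ x then 0
      else if M.dK (lastState a₀ h) (lab n) x then 1 / ((e : NNReal) + 2) else 1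

variable {M lab a₀}

theorem IsHistory.tail {s : Step W} {h : List (Step W)} (hh : M.IsHistory lab a₀ (s :: h)) :
    M.IsHistory lab a₀ h := by
  obtain ⟨n, _ | e, b⟩ := s <;> exact hh.1

theorem IsHistory.of_suffix {h g : List (Step W)} (hh : M.IsHistory lab a₀ h) (hg : g <:+ h) :
    M.IsHistory lab a₀ g := by
  obtain ⟨p, rfl⟩ := hg
  induction p with
  | nil => exact hh
  | cons s p ih => exact ih hh.tail

theorem one_div_add_two_lt_one (e : ℕ) : 1 / ((e : NNReal) + 2) < 1 := by
  rw [div_lt_one (by positivity)]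
  exact lt_of_lt_of_le one_lt_two le_add_self

theorem one_div_add_two_pos (e : ℕ) : 0 < 1 / ((e : NNReal) + 2) := by positivity

theorem dD_of_dD_empty {X : Finset Var} {y : Var} {a : W} (hX : X ⊆ V) (hy : y ∈ V)
    (h : M.dD a ∅ y) : M.dD a X y :=
  M.dD_trans hX (Finset.empty_subset V) hy (by simp) h

theorem dK_of_dD_empty {X : Finset Var} {y : Var} {a : W} (hX : X ⊆ V) (hy : y ∈ V)
    (h : M.dD a ∅ y) : M.dK a X y :=
  M.dK_trans hX (Finset.empty_subset V) hy (by simp) (M.dK_empty hy h)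

/-! ### Lengths of single edges. -/

section Edges

variable {x y : Var} {X : Finset Var} {n e : ℕ} {b : W} {s : Step W} {h : List (Step W)}

theorem edgeLen_none_lt_one (hx : x ∈ V)
    (hlt : M.edgeLen lab a₀ x ((n, none, b) :: h) < 1) : M.dD (lastState a₀ h) (lab n) x := by
  by_contra hn
  simp [edgeLen, hx, hn] at hlt

theorem edgeLen_none_eq_zero (hd : x ∈ V → M.dD (lastState a₀ h) (lab n) x) :
    M.edgeLen lab a₀ x ((n, none, b) :: h) = 0 := by
  simp only [edgeLen]
  rw [if_pos hd]

theorem edgeLen_some_lt_one (hlab : ∀ n, lab n ⊆ V) (hx : x ∈ V)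
    (hlt : M.edgeLen lab a₀ x ((n, some e, b) :: h) < 1) : M.dK (lastState a₀ h) (lab n) x := by
  by_contra hn
  have h₁ : ¬ M.dD (lastState a₀ h) ∅ x := fun h₁ => hn (dK_of_dD_empty (hlab n) hx h₁)
  simp [edgeLen, hx, hn, h₁] at hlt

theorem edgeLen_some_eq_zero_iff (hx : x ∈ V) :
    M.edgeLen lab a₀ x ((n, some e, b) :: h) = 0 ↔ M.dD (lastState a₀ h) ∅ x := by
  refine ⟨fun h₁ => ?_, fun h₁ => by simp [edgeLen, h₁]⟩
  by_contra hn
  simp only [edgeLen, hx, hn] at h₁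
  split_ifs at h₁ with h₂ h₃
  · exact h₂ trivial
  · exact (one_div_add_two_pos e).ne' h₁
  · exact one_ne_zero h₁

theorem edgeLen_some_le (hd : M.dK (lastState a₀ h) (lab n) x) :
    M.edgeLen lab a₀ x ((n, some e, b) :: h) ≤ 1 / ((e : NNReal) + 2) := by
  simp only [edgeLen, hd, if_true]
  split_ifs
  · exact zero_le
  · exact le_rfl

theorem le_edgeLen_some (hx : x ∈ V) (hd : ¬ M.dD (lastState a₀ h) ∅ x) :
    1 / ((e : NNReal) + 2) ≤ M.edgeLen lab a₀ x ((n, some e, b) :: h) := by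
  simp only [edgeLen, hx, hd]
  split_ifs with h₁
  · exact absurd (h₁ trivial) id
  · exact le_rfl
  · exact (one_div_add_two_lt_one e).le

theorem edgeLen_of_notMem (hx : x ∉ V) : M.edgeLen lab a₀ x h = 0 := by
  rcases h with _ | ⟨⟨n, _ | e, b⟩, h⟩ <;> simp [edgeLen, hx]

/-- A closeness step has length 0 only for constants, and constants depend on `∅`, for which all
states are equivalent. -/
theorem eqv_of_edgeLen_eq_zero (hlab : ∀ n, lab n ⊆ V) (hh : M.IsHistory lab a₀ (s :: h))
    (hX : X ⊆ V) (hz : ∀ x ∈ X, M.edgeLen lab a₀ x (s :: h) = 0) :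
    M.eqv X (lastState a₀ h) (lastState a₀ (s :: h)) := by
  obtain ⟨n, _ | e, b⟩ := s
  · exact M.eqv_of_dD (hlab n) hX
      (fun x hx => edgeLen_none_lt_one (hX hx) (by rw [hz x hx]; exact one_pos)) hh.2
  · exact M.eqv_of_dD (Finset.empty_subset V) hX
      (fun x hx => (edgeLen_some_eq_zero_iff (hX hx)).1 (hz x hx)) (M.eqv_empty _ _)

theorem le_of_edgeLen_lt_one (hlab : ∀ n, lab n ⊆ V) (hh : M.IsHistory lab a₀ (s :: h))
    (hX : X ⊆ V) (hz : ∀ x ∈ X, M.edgeLen lab a₀ x (s :: h) < 1) :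
    M.le X (lastState a₀ h) (lastState a₀ (s :: h)) := by
  obtain ⟨n, _ | e, b⟩ := s
  · exact M.eqv_le hX (M.eqv_of_dD (hlab n) hX
      (fun x hx => edgeLen_none_lt_one (hX hx) (hz x hx)) hh.2)
  · exact M.le_of_dK (hlab n) hX
      (fun x hx => edgeLen_some_lt_one hlab (hX hx) (hz x hx)) hh.2

theorem edgeLen_eq_zero_of_dD (hlab : ∀ n, lab n ⊆ V) (hX : X ⊆ V)
    (hz : ∀ x ∈ X, M.edgeLen lab a₀ x (s :: h) = 0) (hd : M.dD (lastState a₀ h) X y) :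
    M.edgeLen lab a₀ y (s :: h) = 0 := by
  by_cases hy : y ∈ V
  swap
  · exact edgeLen_of_notMem hy
  obtain ⟨n, _ | e, b⟩ := s
  · exact edgeLen_none_eq_zero fun _ => M.dD_trans (hlab n) hX hy
      (fun x hx => edgeLen_none_lt_one (hX hx) (by rw [hz x hx]; exact one_pos)) hd
  · exact (edgeLen_some_eq_zero_iff hy).2 (M.dD_trans (Finset.empty_subset V) hX hy
      (fun x hx => (edgeLen_some_eq_zero_iff (hX hx)).1 (hz x hx)) hd)

/-- On a closeness step, either all of `X` is constant, and then so is `y`, or some nonconstant `x`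
sees at least `1 / (e + 2)`, which bounds what `y` sees. Equality steps are not seen by `y` at all.
-/
theorem edgeLen_le_of_dK (hlab : ∀ n, lab n ⊆ V) (hX : X ⊆ V)
    (hz : ∀ x ∈ X, M.edgeLen lab a₀ x (s :: h) < 1) (hd : M.dK (lastState a₀ h) X y) :
    M.edgeLen lab a₀ y (s :: h) = 0 ∨
      ∃ x ∈ X, M.edgeLen lab a₀ y (s :: h) ≤ M.edgeLen lab a₀ x (s :: h) := by
  by_cases hy : y ∈ V
  swap
  · exact .inl (edgeLen_of_notMem hy)
  obtain ⟨n, _ | e, b⟩ := s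
  · exact .inl (edgeLen_none_eq_zero fun _ => M.dD_trans (hlab n) hX hy
      (fun x hx => edgeLen_none_lt_one (hX hx) (hz x hx)) (M.dD_of_dK hX hy hd))
  · by_cases hc : ∀ x ∈ X, M.dD (lastState a₀ h) ∅ x
    · refine .inl ((edgeLen_some_eq_zero_iff hy).2 (M.dD_of_dK (Finset.empty_subset V) hy ?_))
      exact M.dK_trans (Finset.empty_subset V) hX hy (fun x hx => M.dK_empty (hX hx) (hc x hx)) hd
    · push Not at hc
      obtain ⟨x, hx, hxc⟩ := hc
      refine .inr ⟨x, hx, (edgeLen_some_le ?_).trans (le_edgeLen_some (hX hx) hxc)⟩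
      exact M.dK_trans (hlab n) hX hy
        (fun x hx => edgeLen_some_lt_one hlab (hX hx) (hz x hx)) hd

variable (M lab a₀) in
/-- Edges above a given history that are short enough have length zero. -/
theorem exists_radius (h : List (Step W)) : ∃ r : NNReal, 0 < r ∧ r ≤ 1 ∧
    ∀ a, a <:+ h → ∀ x, M.edgeLen lab a₀ x a < r → M.edgeLen lab a₀ x a = 0 := by
  -- There are finitely many edges above `h`; the radius is the minimum of 1 and the lengths `1 / (e
  -- + 2)` of the closeness steps among them.
  induction h with
  | nil =>
    refine ⟨1, one_pos, le_rfl, fun a ha x _ => ?_⟩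
    rw [List.suffix_nil.1 ha, edgeLen]
  | cons s h ih =>
    obtain ⟨r, hr, hr₁, hrh⟩ := ih
    obtain ⟨n, _ | e, b⟩ := s
    · refine ⟨r, hr, hr₁, fun a ha x hx => ?_⟩
      rcases List.suffix_cons_iff.1 ha with rfl | ha
      · simp only [edgeLen] at hx ⊢
        split_ifs at hx ⊢
        · rfl
        · exact absurd (hx.trans_le hr₁) (lt_irrefl _)
      · exact hrh a ha x hx
    · refine ⟨min r (1 / ((e : NNReal) + 2)), lt_min hr (one_div_add_two_pos e),
        (min_le_left _ _).trans hr₁, fun a ha x hx => ?_⟩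
      rcases List.suffix_cons_iff.1 ha with rfl | ha
      · simp only [edgeLen] at hx ⊢
        split_ifs at hx ⊢
        · rfl
        · exact absurd (hx.trans_le (min_le_right _ _)) (lt_irrefl _)
        · exact absurd (hx.trans_le ((min_le_left _ _).trans hr₁)) (lt_irrefl _)
      · exact hrh a ha x (hx.trans_le (min_le_left _ _))

end Edges

/-! ### Distances of histories and the relations of the premodel. -/

section Paths

variable {y : Var} {X : Finset Var} {h h' : List (Step W)}

variable (M lab a₀) in
/-- The distance of two histories as seen by `x`. -/
noncomputable def histDist (x : Var) : List (Step W) → List (Step W) → NNReal :=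
  treeDist (M.edgeLen lab a₀ x)

theorem eqv_of_histDist_eq_zero (hlab : ∀ n, lab n ⊆ V) (hh : M.IsHistory lab a₀ h)
    (hh' : M.IsHistory lab a₀ h') (hX : X ⊆ V)
    (hz : ∀ x ∈ X, M.histDist lab a₀ x h h' = 0) :
    M.eqv X (lastState a₀ h) (lastState a₀ h') := by
  have hedge : ∀ a ∈ treePath h h', ∀ x ∈ X, M.edgeLen lab a₀ x a = 0 := fun a ha x hx =>
    le_antisymm ((le_treeDist ha).trans (hz x hx).le) zero_le
  exact rel_of_treePath (lastState a₀) (fun b => M.eqv_refl b hX) (M.eqv_trans hX)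
    (fun s g hs hm => M.eqv_symm hX
      (eqv_of_edgeLen_eq_zero hlab (hh.of_suffix hs) hX (hedge _ hm)))
    (fun s g hs hm => eqv_of_edgeLen_eq_zero hlab (hh'.of_suffix hs) hX (hedge _ hm))

theorem isHistory_of_mem_treePath {a : List (Step W)} (hh : M.IsHistory lab a₀ h)
    (hh' : M.IsHistory lab a₀ h') (ha : a ∈ treePath h h') : M.IsHistory lab a₀ a := by
  rcases mem_treePath.1 ha with h₁ | h₁
  · exact hh.of_suffix h₁.1
  · exact hh'.of_suffix h₁.1

/-- The stretch from `h` to each edge also has `X`-length 0, so the start of the edge is `X`-equal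
to `h` and inherits the dependence of `y` on `X`; hence `y` does not see the edge. -/
theorem histDist_eq_zero_of_dD (hlab : ∀ n, lab n ⊆ V) (hh : M.IsHistory lab a₀ h)
    (hh' : M.IsHistory lab a₀ h') (hX : X ⊆ V) (hy : y ∈ V)
    (hz : ∀ x ∈ X, M.histDist lab a₀ x h h' = 0) (hd : M.dD (lastState a₀ h) X y) :
    M.histDist lab a₀ y h h' = 0 := by
  refine le_antisymm (treeDist_le fun a ha => ?_) zero_le
  obtain ⟨s, g, rfl⟩ := List.exists_cons_of_ne_nil (ne_nil_of_mem_treePath ha)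
  have hg := isHistory_of_mem_treePath hh hh' ha
  have h₁ := eqv_of_histDist_eq_zero hlab hh hg.tail hX fun x hx =>
    le_antisymm ((treeDist_le_of_mem ha).trans (hz x hx).le) zero_le
  exact (edgeLen_eq_zero_of_dD hlab hX (fun x hx =>
    le_antisymm ((le_treeDist ha).trans (hz x hx).le) zero_le) (M.dD_eqv hX hy h₁ hd)).le

/-- Upward edges lie above `h`, so below the radius they have length 0 and give symmetric equality.
Downward edges need only length below 1, and they run in the direction of closeness. -/
theorem le_of_histDist_lt (hlab : ∀ n, lab n ⊆ V) (hh : M.IsHistory lab a₀ h)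
    (hh' : M.IsHistory lab a₀ h') (hX : X ⊆ V) {r : NNReal} (hr₁ : r ≤ 1)
    (hr : ∀ a, a <:+ h → ∀ x, M.edgeLen lab a₀ x a < r → M.edgeLen lab a₀ x a = 0)
    (hz : ∀ x ∈ X, M.histDist lab a₀ x h h' < r) :
    M.le X (lastState a₀ h) (lastState a₀ h') := by
  have hedge : ∀ a ∈ treePath h h', ∀ x ∈ X, M.edgeLen lab a₀ x a < r := fun a ha x hx =>
    (le_treeDist ha).trans_lt (hz x hx)
  refine rel_of_treePath (lastState a₀) (fun b => M.eqv_le hX (M.eqv_refl b hX)) (M.le_trans hX)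
    (fun s g hs hm => M.eqv_le hX (M.eqv_symm hX
      (eqv_of_edgeLen_eq_zero hlab (hh.of_suffix hs) hX fun x hx => ?_)))
    (fun s g hs hm => le_of_edgeLen_lt_one hlab (hh'.of_suffix hs) hX
      fun x hx => (hedge _ hm x hx).trans_le hr₁)
  exact hr _ hs x (hedge _ hm x hx)

/-- Closeness carries the knowable dependence from `h` to the start of each edge, where `y` sees
nothing or no more than some `x ∈ X`. So `ε` serves as its own modulus of continuity. -/
theorem histDist_lt_of_dK (hlab : ∀ n, lab n ⊆ V) (hh : M.IsHistory lab a₀ h)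
    (hh' : M.IsHistory lab a₀ h') (hX : X ⊆ V) (hy : y ∈ V) {r ε : NNReal} (hr₁ : r ≤ 1)
    (hr : ∀ a, a <:+ h → ∀ x, M.edgeLen lab a₀ x a < r → M.edgeLen lab a₀ x a = 0)
    (hε : 0 < ε) (hεr : ε ≤ r) (hz : ∀ x ∈ X, M.histDist lab a₀ x h h' < ε)
    (hd : M.dK (lastState a₀ h) X y) : M.histDist lab a₀ y h h' < ε := by
  refine (Finset.sup_lt_iff hε).2 fun a ha => ?_
  obtain ⟨s, g, rfl⟩ := List.exists_cons_of_ne_nil (ne_nil_of_mem_treePath ha)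
  have hg := isHistory_of_mem_treePath hh hh' ha
  have h₁ := le_of_histDist_lt hlab hh hg.tail hX hr₁ hr fun x hx =>
    (treeDist_le_of_mem ha).trans_lt ((hz x hx).trans_le hεr)
  have hedge : ∀ x ∈ X, M.edgeLen lab a₀ x (s :: g) < ε := fun x hx =>
    (le_treeDist ha).trans_lt (hz x hx)
  rcases edgeLen_le_of_dK hlab hX (fun x hx => (hedge x hx).trans_le (hεr.trans hr₁))
    (M.dK_le hX hy h₁ hd) with h₂ | ⟨x, hx, h₂⟩
  · rw [h₂]
    exact hε
  · exact h₂.trans_lt (hedge x hx)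

/-- Where `y` sees a small distance, a variable that is not globally constant sees no smaller
one. -/
theorem histDist_le_histDist {x : Var} (hx : ∀ a, ¬ M.dD a ∅ x) (hxV : x ∈ V)
    (hy₁ : M.histDist lab a₀ y h h' < 1) (hlab : ∀ n, lab n ⊆ V) :
    M.histDist lab a₀ y h h' ≤ M.histDist lab a₀ x h h' := by
  refine treeDist_le fun a ha => _root_.le_trans ?_ (le_treeDist ha)
  have hya := (le_treeDist ha).trans_lt hy₁
  by_cases hy : y ∈ V
  swap
  · rw [edgeLen_of_notMem hy]
    exact zero_le
  obtain ⟨⟨n, _ | e, b⟩, g, rfl⟩ := List.exists_cons_of_ne_nil (ne_nil_of_mem_treePath ha)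
  · rw [edgeLen_none_eq_zero fun _ => edgeLen_none_lt_one hy hya]
    exact zero_le
  · exact (edgeLen_some_le (edgeLen_some_lt_one hlab hy hya)).trans (le_edgeLen_some hxV (hx _))

/-- Constancy at one state holds at all, since dependence on `∅` is preserved by `∅`-equality. -/
theorem histDist_eq_zero_of_constant {x : Var} {a : W} (hlab : ∀ n, lab n ⊆ V)
    (hx : x ∈ V → M.dD a ∅ x) : M.histDist lab a₀ x h h' = 0 := by
  refine le_antisymm (treeDist_le fun c hc => ?_) zero_le
  by_cases hxV : x ∈ V
  swap
  · rw [edgeLen_of_notMem hxV]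
  have hall : ∀ b, M.dD b ∅ x := fun b =>
    M.dD_eqv (Finset.empty_subset V) hxV (M.eqv_empty a b) (hx hxV)
  obtain ⟨⟨n, _ | e, b⟩, g, rfl⟩ := List.exists_cons_of_ne_nil (ne_nil_of_mem_treePath hc)
  · exact (edgeLen_none_eq_zero fun _ => dD_of_dD_empty (hlab n) hxV (hall _)).le
  · exact ((edgeLen_some_eq_zero_iff hxV).2 (hall _)).le

end Paths

end Premodel

/-! ### Metric semantics -/

namespace MetricDepModel

variable {Var : Type u} {Pred : Type v} {ar : Pred → ℕ}
  (M : MetricDepModel.{u, v, w, w'} Var Pred ar)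

theorem hasBasis_nhdsAt (X : Finset Var) (s : M.toTopoDepModel.State) :
    (M.toTopoDepModel.nhdsAt X s).HasBasis (fun r : ℝ => 0 < r)
      (fun r => {t | ∀ x ∈ X, dist (α := M.D x) (M.val x t) (M.val x s) < r}) := by
  rw [TopoDepModel.nhdsAt_eq_comap]
  have hb : (𝓝 (M.toTopoDepModel.joint X s)).HasBasis (fun r : ℝ => 0 < r)
      (Metric.ball (α := ∀ x : X, M.D x) (M.toTopoDepModel.joint X s)) :=
    Metric.nhds_basis_ball (α := ∀ x : X, M.D x)
  refine (hb.comap _).to_hasBasis (fun r hr => ⟨r, hr, fun t ht => ?_⟩)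
    (fun r hr => ⟨r, hr, fun t ht x hx => ?_⟩)
  · exact (dist_pi_lt_iff (X := fun x : X => M.D x) hr).2 fun x => ht x.1 x.2
  · exact (dist_pi_lt_iff (X := fun x : X => M.D x) hr).1 ht ⟨x, hx⟩

theorem eventually_nhdsAt_iff {X : Finset Var} {s : M.State} {p : M.State → Prop} :
    (∀ᶠ t in M.toTopoDepModel.nhdsAt X s, p t) ↔
      ∃ r > 0, ∀ t, (∀ x ∈ X, dist (M.val x t) (M.val x s) < r) → p t :=
  (M.hasBasis_nhdsAt X s).eventually_iff

theorem sat_kmod_iff {X : Finset Var} {s : M.State} {φ : Formula Var Pred ar} :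
    M.toTopoDepModel.Sat s (.kmod X φ) ↔
      ∃ r > 0, ∀ t, (∀ x ∈ X, dist (M.val x t) (M.val x s) < r) → M.toTopoDepModel.Sat t φ :=
  M.toTopoDepModel.sat_kmod.trans M.eventually_nhdsAt_iff

theorem nhdsAt_le_iff {X Y : Finset Var} {s : M.State} :
    M.toTopoDepModel.nhdsAt X s ≤ M.toTopoDepModel.nhdsAt Y s ↔
      ∀ ε > 0, ∃ δ > 0, ∀ t, (∀ x ∈ X, dist (M.val x t) (M.val x s) < δ) →
        ∀ y ∈ Y, dist (M.val y t) (M.val y s) < ε := by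
  constructor
  · intro h ε hε
    exact M.eventually_nhdsAt_iff.1 (h (M.eventually_nhdsAt_iff.2 ⟨ε, hε, fun t ht => ht⟩))
  · intro h A hA
    obtain ⟨ε, hε, hA⟩ := M.eventually_nhdsAt_iff.1 hA
    obtain ⟨δ, hδ, h⟩ := h ε hε
    exact M.eventually_nhdsAt_iff.2 ⟨δ, hδ, fun t ht => hA t (h t ht)⟩

theorem sat_kdep_iff {X Y : Finset Var} {s : M.State} :
    M.toTopoDepModel.Sat s (.kdep X Y) ↔
      ∃ r > 0, ∀ t, (∀ x ∈ X, dist (M.val x t) (M.val x s) < r) →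
        ∀ ε > 0, ∃ δ > 0, ∀ t', (∀ x ∈ X, dist (M.val x t') (M.val x t) < δ) →
          ∀ y ∈ Y, dist (M.val y t') (M.val y t) < ε :=
  (M.toTopoDepModel.sat_kdep.trans M.eventually_nhdsAt_iff).trans
    (exists_congr fun _ => and_congr_right fun _ => forall₂_congr fun _ _ => M.nhdsAt_le_iff)

end MetricDepModel

/-! ### The model of histories -/

namespace Premodel

variable {Var : Type u} {Pred : Type v} {ar : Pred → ℕ} [DecidableEq Var]
  {V : Finset Var} {S : Set (Formula Var Pred ar)} {W : Type}
  (M : Premodel V S W) (lab : ℕ → Finset Var) (a₀ : W) (idx : Var → ℕ)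

/-- The histories of a premodel from a given initial state. -/
def History : Type := {h : List (Step W) // M.IsHistory lab a₀ h}

/-- The value of `x` at a history: its class modulo distance zero, tagged by the variable. -/
def histValue (x : Var) (h : M.History lab a₀) : ULift.{w} (ℕ × Set (M.History lab a₀)) :=
  ⟨idx x, {h' | M.histDist lab a₀ x h.1 h'.1 = 0}⟩

variable {M lab a₀ idx}

theorem histDist_self (x : Var) (h : List (Step W)) : M.histDist lab a₀ x h h = 0 :=
  treeDist_self

theorem histDist_comm (x : Var) (h h' : List (Step W)) :
    M.histDist lab a₀ x h h' = M.histDist lab a₀ x h' h :=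
  treeDist_comm

theorem histDist_triangle (x : Var) (h h' h'' : List (Step W)) :
    M.histDist lab a₀ x h h'' ≤ max (M.histDist lab a₀ x h h') (M.histDist lab a₀ x h' h'') :=
  treeDist_triangle

theorem histDist_cons {x : Var} {s : Step W} {h : List (Step W)} :
    M.histDist lab a₀ x h (s :: h) = M.edgeLen lab a₀ x (s :: h) :=
  treeDist_cons

theorem histDist_congr_left {x : Var} {h h' : List (Step W)} (h₀ : M.histDist lab a₀ x h h' = 0)
    (k : List (Step W)) : M.histDist lab a₀ x h k = M.histDist lab a₀ x h' k := by
  apply le_antisymm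
  · simpa [h₀] using histDist_triangle (M := M) (lab := lab) (a₀ := a₀) x h h' k
  · simpa [histDist_comm x h' h, h₀] using
      histDist_triangle (M := M) (lab := lab) (a₀ := a₀) x h' h k

theorem histDist_congr_right {x : Var} {h h' : List (Step W)} (h₀ : M.histDist lab a₀ x h h' = 0)
    (k : List (Step W)) : M.histDist lab a₀ x k h = M.histDist lab a₀ x k h' := by
  rw [histDist_comm x k h, histDist_comm x k h', histDist_congr_left h₀]

theorem snd_histValue_eq_iff {x : Var} {h h' : M.History lab a₀} :
    (histValue.{u, v, w} M lab a₀ idx x h).down.2 = (histValue.{u, v, w} M lab a₀ idx x h').down.2 ↔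
      M.histDist lab a₀ x h.1 h'.1 = 0 := by
  constructor
  · intro he
    have : h' ∈ {k : M.History lab a₀ | M.histDist lab a₀ x h'.1 k.1 = 0} := histDist_self x _
    exact (Set.ext_iff.1 he h').2 this
  · intro h₀
    ext k
    change M.histDist lab a₀ x h.1 k.1 = 0 ↔ M.histDist lab a₀ x h'.1 k.1 = 0
    rw [histDist_congr_left h₀]

theorem histValue_eq_iff {x : Var} {h h' : M.History lab a₀} :
    histValue.{u, v, w} M lab a₀ idx x h = histValue.{u, v, w} M lab a₀ idx x h' ↔
      M.histDist lab a₀ x h.1 h'.1 = 0 := by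
  rw [← snd_histValue_eq_iff (idx := idx)]
  refine ⟨fun he => by rw [he], fun he => ?_⟩
  exact ULift.ext _ _ (Prod.ext rfl he)

variable (M lab a₀ idx) in
/-- The metric dependence model of histories. -/
noncomputable def historyModel : MetricDepModel.{u, v, w, w'} Var Pred ar where
  Value := ULift.{w} (ℕ × Set (M.History lab a₀))
  D x := Set.range (histValue.{u, v, w} M lab a₀ idx x)
  metric x :=
    { dist := fun p q => M.histDist lab a₀ x p.2.choose.1 q.2.choose.1
      dist_self := fun p => by simp [histDist_self]
      dist_comm := fun p q => by rw [histDist_comm]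
      dist_triangle := fun p q r => by
        rw [← NNReal.coe_add, NNReal.coe_le_coe]
        exact (histDist_triangle x _ q.2.choose.1 _).trans (max_le_add_of_nonneg zero_le zero_le)
      eq_of_dist_eq_zero := fun {p q} h => by
        have h₁ : histValue.{u, v, w} M lab a₀ idx x p.2.choose =
            histValue.{u, v, w} M lab a₀ idx x q.2.choose :=
          histValue_eq_iff.2 (NNReal.coe_eq_zero.1 h)
        rw [p.2.choose_spec, q.2.choose_spec] at h₁
        exact Subtype.ext h₁ }
  -- The tags carried by the values let a tuple of values reveal the variables in `V` from which it
  -- came.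
  I P := {f | ∃ xs : Fin (ar P) → Var, (∀ i, xs i ∈ V) ∧ .atom P xs ∈ S ∧ ∃ h : M.History lab a₀,
    (∀ i, (f i : ULift.{w} (ℕ × Set (M.History lab a₀))) =
        histValue.{u, v, w} M lab a₀ idx (xs i) h) ∧
      M.tr (lastState a₀ h.1) (.atom P xs)}
  State := ULift.{w'} (M.History lab a₀)
  val x s := ⟨histValue.{u, v, w} M lab a₀ idx x s.down, s.down, rfl⟩
  surj x := by
    rintro ⟨_, h, rfl⟩
    exact ⟨⟨h⟩, rfl⟩

theorem historyModel_val_eq_iff {x : Var} {s t : (historyModel.{u, v, w, w'} M lab a₀ idx).State} :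
    (historyModel.{u, v, w, w'} M lab a₀ idx).val x s =
        (historyModel.{u, v, w, w'} M lab a₀ idx).val x t ↔
      M.histDist lab a₀ x s.down.1 t.down.1 = 0 :=
  Subtype.ext_iff.trans histValue_eq_iff

/-- The metric is defined through chosen representatives; histories at distance 0 have the same
distances to all others, so the choice is immaterial. -/
theorem historyModel_dist {x : Var} (s t : (historyModel.{u, v, w, w'} M lab a₀ idx).State) :
    dist ((historyModel.{u, v, w, w'} M lab a₀ idx).val x s)
        ((historyModel.{u, v, w, w'} M lab a₀ idx).val x t) =
      M.histDist lab a₀ x s.down.1 t.down.1 := by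
  have hs := ((historyModel.{u, v, w, w'} M lab a₀ idx).val x s).2.choose_spec
  have ht := ((historyModel.{u, v, w, w'} M lab a₀ idx).val x t).2.choose_spec
  change (M.histDist lab a₀ x ((historyModel.{u, v, w, w'} M lab a₀ idx).val x s).2.choose.1
    ((historyModel.{u, v, w, w'} M lab a₀ idx).val x t).2.choose.1 : ℝ) = _
  rw [NNReal.coe_inj]
  rw [histDist_congr_left (histValue_eq_iff.1 hs), histDist_congr_right (histValue_eq_iff.1 ht)]

theorem historyModel_joint_eq_iff {X : Finset Var}
    {s t : (historyModel.{u, v, w, w'} M lab a₀ idx).State} :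
    (historyModel.{u, v, w, w'} M lab a₀ idx).toTopoDepModel.joint X s =
        (historyModel.{u, v, w, w'} M lab a₀ idx).toTopoDepModel.joint X t ↔
      ∀ x ∈ X, M.histDist lab a₀ x s.down.1 t.down.1 = 0 := by
  exact (TopoDepModel.joint_eq_iff _).trans (forall₂_congr fun x _ => historyModel_val_eq_iff)

end Premodel

/-! ### The truth lemma and the Lipschitz property for the model of histories. -/

namespace Premodel

variable {Var : Type u} {Pred : Type v} {ar : Pred → ℕ} [DecidableEq Var]
  {V : Finset Var} {S : Set (Formula Var Pred ar)} {W : Type}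
  {M : Premodel V S W} {lab : ℕ → Finset Var} {a₀ : W} {idx : Var → ℕ}

theorem exists_one_div_add_two_lt {r : NNReal} (hr : 0 < r) :
    ∃ e : ℕ, 1 / ((e : NNReal) + 2) < r := by
  obtain ⟨e, he⟩ := exists_nat_one_div_lt hr
  refine ⟨e, lt_of_le_of_lt ?_ he⟩
  gcongr
  exact one_le_two

theorem historyModel_dist_lt {x : Var} {s t : (historyModel.{u, v, w, w'} M lab a₀ idx).State}
    {r : NNReal} :
    dist ((historyModel.{u, v, w, w'} M lab a₀ idx).val x t)
        ((historyModel.{u, v, w, w'} M lab a₀ idx).val x s) < r ↔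
      M.histDist lab a₀ x s.down.1 t.down.1 < r := by
  rw [historyModel_dist, NNReal.coe_lt_coe, histDist_comm]

/-- Truth at a history is truth at its last state. -/
theorem sat_historyModel (hS : IsClosedUnder V S) (hlab : ∀ n, lab n ⊆ V)
    (hlab' : ∀ X ⊆ V, ∃ n, lab n = X) (hidx : Set.InjOn idx V) {φ : Formula Var Pred ar}
    (hφ : φ ∈ S) (s : (historyModel.{u, v, w, w'} M lab a₀ idx).State) :
    (historyModel.{u, v, w, w'} M lab a₀ idx).toTopoDepModel.Sat s φ ↔
      M.tr (lastState a₀ s.down.1) φ := by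
  let H := historyModel.{u, v, w, w'} M lab a₀ idx
  induction φ generalizing s with
  | atom P xs =>
    have hV : ∀ i, xs i ∈ V := fun i => hS.atom P xs hφ (by simp)
    constructor
    · rintro ⟨xs', hV', -, h, hval, htr⟩
      have hxs : xs' = xs := by
        funext i
        exact hidx (hV' i) (hV i) (congrArg (fun p => p.down.1) (hval i)).symm
      subst hxs
      refine M.tr_atom hφ (eqv_of_histDist_eq_zero hlab h.2 s.down.2 (hS.atom P xs' hφ) ?_) htr
      intro x hx
      obtain ⟨i, -, rfl⟩ := Finset.mem_image.1 hx
      rw [histDist_comm]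
      exact histValue_eq_iff.1 (hval i)
    · intro htr
      exact ⟨xs, hV, hφ, s.down, fun i => rfl, htr⟩
  | neg φ ih =>
    exact (TopoDepModel.sat_neg _).trans
      ((not_congr (ih (hS.neg _ hφ) s)).trans (M.tr_neg hφ).symm)
  | and φ ψ ih₁ ih₂ =>
    exact (TopoDepModel.sat_and _).trans ((and_congr (ih₁ (hS.and _ _ hφ).1 s)
      (ih₂ (hS.and _ _ hφ).2 s)).trans (M.tr_and hφ).symm)
  | dmod X φ ih =>
    obtain ⟨hX, hφ'⟩ := hS.dmod _ _ hφ
    refine ((TopoDepModel.sat_dmod _).trans ⟨fun h b hb => ?_, fun h t ht => ?_⟩).trans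
      (M.tr_dmod hφ).symm
    · obtain ⟨n, rfl⟩ := hlab' X hX
      -- Extending the history by an equality step to `b` keeps all values of `X`.
      let t : H.State := ⟨⟨(n, none, b) :: s.down.1, s.down.2, hb⟩⟩
      refine (ih hφ' t).1 (h t (historyModel_joint_eq_iff.2 fun x hx => ?_))
      exact histDist_cons.trans (edgeLen_none_eq_zero fun _ => M.dD_of_mem _ hX hx)
    · exact (ih hφ' t).2 (h _ (eqv_of_histDist_eq_zero hlab s.down.2 t.down.2 hX
        (historyModel_joint_eq_iff.1 ht)))
  | kmod X φ ih =>
    obtain ⟨hX, hφ'⟩ := hS.kmod _ _ hφ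
    refine (H.sat_kmod_iff.trans ⟨fun h b hb => ?_, fun h => ?_⟩).trans
      (M.tr_kmod hφ).symm
    · obtain ⟨r, hr, h⟩ := h
      obtain ⟨n, rfl⟩ := hlab' X hX
      lift r to NNReal using hr.le
      obtain ⟨e, he⟩ := exists_one_div_add_two_lt (NNReal.coe_pos.1 hr)
      -- With `e` large, the closeness step to `b` stays within the given radius.
      let t : H.State := ⟨⟨(n, some e, b) :: s.down.1, s.down.2, hb⟩⟩
      refine (ih hφ' t).1 (h t fun x hx => historyModel_dist_lt.2 ?_)
      exact (histDist_cons.trans_le (edgeLen_some_le (M.dK_of_mem _ hX hx))).trans_lt he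
    · obtain ⟨r, hr, hr₁, hrs⟩ := M.exists_radius lab a₀ s.down.1
      refine ⟨r, NNReal.coe_pos.2 hr, fun t ht => (ih hφ' t).2 (h _ ?_)⟩
      exact le_of_histDist_lt hlab s.down.2 t.down.2 hX hr₁ hrs
        fun x hx => historyModel_dist_lt.1 (ht x hx)
  | ddep X Y =>
    obtain ⟨hX, hY⟩ := hS.ddep _ _ hφ
    refine ((TopoDepModel.sat_ddep _).trans ⟨fun h y hy => ?_, fun h t ht => ?_⟩).trans
      (M.tr_ddep hφ).symm
    · obtain ⟨n, rfl⟩ := hlab' X hX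
      -- A step that remains at the same state still has length 1 for each `y ∈ Y` that does not
      -- depend on `X`.
      let t : H.State := ⟨⟨(n, none, lastState a₀ s.down.1) :: s.down.1, s.down.2,
        M.eqv_refl _ hX⟩⟩
      have h₁ := historyModel_joint_eq_iff.1 (h t (historyModel_joint_eq_iff.2 fun x hx =>
        histDist_cons.trans (edgeLen_none_eq_zero fun _ => M.dD_of_mem _ hX hx))) y hy
      exact edgeLen_none_lt_one (hY hy) ((histDist_cons.symm.trans h₁).trans_lt one_pos)
    · exact historyModel_joint_eq_iff.2 fun y hy => histDist_eq_zero_of_dD hlab s.down.2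
        t.down.2 hX (hY hy) (historyModel_joint_eq_iff.1 ht) (h y hy)
  | kdep X Y =>
    obtain ⟨hX, hY⟩ := hS.kdep _ _ hφ
    refine (H.sat_kdep_iff.trans ⟨fun h y hy => ?_, fun h => ?_⟩).trans
      (M.tr_kdep hφ).symm
    · obtain ⟨r, hr, h⟩ := h
      obtain ⟨n, rfl⟩ := hlab' X hX
      -- Continuity at `s` itself with `ε = 1` is enough: a closeness step that stays at the same
      -- state has length 1 for every `y` without knowable dependence on `X`.
      obtain ⟨δ, hδ, h⟩ := h s (fun x _ => by rw [dist_self]; exact hr) 1 one_pos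
      lift δ to NNReal using hδ.le
      obtain ⟨e, he⟩ := exists_one_div_add_two_lt (NNReal.coe_pos.1 hδ)
      let t : H.State := ⟨⟨(n, some e, lastState a₀ s.down.1) :: s.down.1, s.down.2,
        M.eqv_le hX (M.eqv_refl _ hX)⟩⟩
      have h₁ := h t (fun x hx => historyModel_dist_lt.2
        ((histDist_cons.trans_le (edgeLen_some_le (M.dK_of_mem _ hX hx))).trans_lt he)) y hy
      have h₂ : M.histDist lab a₀ y s.down.1 t.down.1 < 1 :=
        (historyModel_dist_lt (r := 1)).1 (by rw [NNReal.coe_one]; exact h₁)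
      exact edgeLen_some_lt_one hlab (hY hy) (histDist_cons.symm.trans_lt h₂)
    · obtain ⟨r, hr, hr₁, hrs⟩ := M.exists_radius lab a₀ s.down.1
      refine ⟨r, NNReal.coe_pos.2 hr, fun t ht ε hε => ?_⟩
      have hle := le_of_histDist_lt hlab s.down.2 t.down.2 hX hr₁ hrs
        fun x hx => historyModel_dist_lt.1 (ht x hx)
      -- The radius at `s` brings the dependence to `t`; continuity at `t` then uses the radius of
      -- `t`.
      obtain ⟨ρ, hρ, hρ₁, hρt⟩ := M.exists_radius lab a₀ t.down.1
      lift ε to NNReal using hε.le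
      refine ⟨(min ρ ε : NNReal), NNReal.coe_pos.2 (lt_min hρ (NNReal.coe_pos.1 hε)),
        fun t' ht' y hy => historyModel_dist_lt.2 ?_⟩
      exact (histDist_lt_of_dK hlab t.down.2 t'.down.2 hX (hY hy) hρ₁ hρt
        (lt_min hρ (NNReal.coe_pos.1 hε)) (min_le_left _ _)
        (fun x hx => historyModel_dist_lt.1 (ht' x hx))
        (M.dK_le hX (hY hy) hle (h y hy))).trans_le (min_le_right _ _)

/-- A nonconstant `x` is nonconstant at every state of the premodel, so it sees each closeness step
at least as long as any `y` for which that step is shorter than 1. Only the ball of radius 1 in the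
target has to be imposed. -/
theorem historyModel_isPseudoLocallyLipschitz (hlab : ∀ n, lab n ⊆ V) :
    (historyModel.{u, v, w, w'} M lab a₀ idx).IsPseudoLocallyLipschitz := by
  intro x y hx
  let H := historyModel.{u, v, w, w'} M lab a₀ idx
  have hxc : ∀ a, ¬ (x ∈ V → M.dD a ∅ x) := fun a ha => hx fun s t =>
    historyModel_val_eq_iff.2 (histDist_eq_zero_of_constant hlab ha)
  have hxV : x ∈ V := by
    by_contra hn
    exact hxc a₀ fun h => absurd h hn
  have hxd : ∀ a, ¬ M.dD a ∅ x := fun a ha => hxc a fun _ => ha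
  let _ := H.statePseudoMetric x
  intro s
  refine ⟨Set.univ, isOpen_univ, trivial, Metric.ball (H.val y s) 1, Metric.isOpen_ball,
    Metric.mem_ball_self one_pos, 1, ?_⟩
  refine LipschitzOnWith.of_dist_le_mul fun p hp q hq => ?_
  have hp' := hp.2
  have hq' := hq.2
  rw [Set.mem_preimage, Metric.mem_ball, ← NNReal.coe_one] at hp' hq'
  replace hp' := historyModel_dist_lt.1 hp'
  replace hq' := historyModel_dist_lt.1 hq'
  rw [NNReal.coe_one, one_mul]
  change _ ≤ dist (H.val x p) (H.val x q)
  rw [historyModel_dist, historyModel_dist, NNReal.coe_le_coe]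
  refine histDist_le_histDist hxd hxV ((histDist_triangle y _ s.down.1 _).trans_lt ?_) hlab
  rw [histDist_comm] at hp'
  exact max_lt hp' hq'

/-- A formula refuted in a premodel is refuted in a pseudo-locally Lipschitz metric model. -/
theorem exists_metricDepModel (hS : IsClosedUnder V S) (M : Premodel V S W) {a : W}
    {φ : Formula Var Pred ar} (hφ : φ ∈ S) (ha : ¬ M.tr a φ) :
    ∃ H : MetricDepModel.{u, v, w, w'} Var Pred ar, H.IsPseudoLocallyLipschitz ∧
      ¬ H.toTopoDepModel.GloballyTrue φ := by
  obtain ⟨lab, hlab⟩ : ∃ lab : ℕ → V.powerset, Function.Surjective lab :=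
    have : Nonempty V.powerset := ⟨⟨∅, by simp⟩⟩
    exists_surjective_nat _
  obtain ⟨f, hf⟩ := exists_injective_nat V
  -- The tag 0 outside `V` may clash, but atoms are interpreted through variables in `V` only.
  let idx : Var → ℕ := fun x => if hx : x ∈ V then f ⟨x, hx⟩ else 0
  have hidx : Set.InjOn idx V := by
    intro x hx y hy hxy
    simp only [idx, Finset.mem_coe.1 hx, Finset.mem_coe.1 hy, dif_pos] at hxy
    exact congrArg Subtype.val (hf hxy)
  have hlabV : ∀ n, (lab n : Finset Var) ⊆ V := fun n => Finset.mem_powerset.1 (lab n).2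
  refine ⟨historyModel.{u, v, w, w'} M (fun n => lab n) a idx,
    historyModel_isPseudoLocallyLipschitz hlabV, fun h => ha ?_⟩
  refine (sat_historyModel hS hlabV (fun X hX => ?_) hidx hφ ⟨⟨[], trivial⟩⟩).1 (h _)
  obtain ⟨n, hn⟩ := hlab ⟨X, Finset.mem_powerset.2 hX⟩
  exact ⟨n, congrArg Subtype.val hn⟩

end Premodel

variable {Var : Type u} {Pred : Type v} {ar : Pred → ℕ} [DecidableEq Var]

/-! ### Completeness -/

/-- The filtration set adds to `S` one formula of each kind for every pair of a subset of `V` and an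
element of `V`. -/
theorem exists_premodel_of_card {V : Finset Var} {S : Finset (Formula Var Pred ar)}
    (hS : IsClosedUnder V (S : Set (Formula Var Pred ar))) {N : ℕ}
    (hN : 2 ^ (S.card + 2 * (2 ^ V.card * V.card)) ≤ N) {φ : Formula Var Pred ar} (hφS : φ ∈ S)
    (hφ : ¬ Provable φ) :
    ∃ (M : Premodel V (S : Set (Formula Var Pred ar)) (Fin N)) (a : Fin N), ¬ M.tr a φ := by
  classical
  let E : Finset (Formula Var Pred ar) := (V.powerset ×ˢ V).image fun p => ddep p.1 {p.2}
  let F : Finset (Formula Var Pred ar) := (V.powerset ×ˢ V).image fun p => kdep p.1 {p.2}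
  refine exists_premodel hS (S ∪ (E ∪ F)) ?_ ((Nat.pow_le_pow_right two_pos ?_).trans hN) hφS hφ
  · rintro α (hα | ⟨X, hX, y, hy, rfl | rfl⟩)
    · exact Finset.mem_union_left _ hα
    · refine Finset.mem_union_right _ (Finset.mem_union_left _
        (Finset.mem_image.2 ⟨(X, y), ?_, rfl⟩))
      exact Finset.mem_product.2 ⟨Finset.mem_powerset.2 hX, hy⟩
    · refine Finset.mem_union_right _ (Finset.mem_union_right _
        (Finset.mem_image.2 ⟨(X, y), ?_, rfl⟩))
      exact Finset.mem_product.2 ⟨Finset.mem_powerset.2 hX, hy⟩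
  · have hc : (V.powerset ×ˢ V).card = 2 ^ V.card * V.card := by
      rw [Finset.card_product, Finset.card_powerset]
    have hE : E.card ≤ 2 ^ V.card * V.card := hc ▸ Finset.card_image_le
    have hF : F.card ≤ 2 ^ V.card * V.card := hc ▸ Finset.card_image_le
    have h₁ := Finset.card_union_le S (E ∪ F)
    have h₂ := Finset.card_union_le E F
    omega

theorem IsClosedUnder.union {V V' : Finset Var} {S S' : Set (Formula Var Pred ar)}
    (h : IsClosedUnder V S) (h' : IsClosedUnder V' S') : IsClosedUnder (V ∪ V') (S ∪ S') where
  atom P xs hm := hm.elim (fun hm => (h.atom P xs hm).trans Finset.subset_union_left)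
    (fun hm => (h'.atom P xs hm).trans Finset.subset_union_right)
  neg φ hm := hm.imp (h.neg φ) (h'.neg φ)
  and φ ψ hm := hm.elim (fun hm => ⟨.inl (h.and φ ψ hm).1, .inl (h.and φ ψ hm).2⟩)
    (fun hm => ⟨.inr (h'.and φ ψ hm).1, .inr (h'.and φ ψ hm).2⟩)
  dmod X φ hm := hm.elim
    (fun hm => ⟨(h.dmod X φ hm).1.trans Finset.subset_union_left, .inl (h.dmod X φ hm).2⟩)
    (fun hm => ⟨(h'.dmod X φ hm).1.trans Finset.subset_union_right, .inr (h'.dmod X φ hm).2⟩)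
  kmod X φ hm := hm.elim
    (fun hm => ⟨(h.kmod X φ hm).1.trans Finset.subset_union_left, .inl (h.kmod X φ hm).2⟩)
    (fun hm => ⟨(h'.kmod X φ hm).1.trans Finset.subset_union_right, .inr (h'.kmod X φ hm).2⟩)
  ddep X Y hm := hm.elim
    (fun hm => (h.ddep X Y hm).imp (·.trans Finset.subset_union_left)
      (·.trans Finset.subset_union_left))
    (fun hm => (h'.ddep X Y hm).imp (·.trans Finset.subset_union_right)
      (·.trans Finset.subset_union_right))
  kdep X Y hm := hm.elim
    (fun hm => (h.kdep X Y hm).imp (·.trans Finset.subset_union_left)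
      (·.trans Finset.subset_union_left))
    (fun hm => (h'.kdep X Y hm).imp (·.trans Finset.subset_union_right)
      (·.trans Finset.subset_union_right))

theorem exists_isClosedUnder (φ : Formula Var Pred ar) :
    ∃ (V : Finset Var) (S : Set (Formula Var Pred ar)), S.Finite ∧ IsClosedUnder V S ∧ φ ∈ S := by
  induction φ with
  | atom P xs =>
    refine ⟨Finset.univ.image xs, {.atom P xs}, Set.finite_singleton _, ?_, rfl⟩
    constructor <;> simp
    rintro Q ys rfl h
    rw [eq_of_heq h]
  | neg φ ih =>
    obtain ⟨V, S, hS, hV, hφ⟩ := ih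
    refine ⟨V, insert (.neg φ) S, hS.insert _, ?_, Set.mem_insert _ _⟩
    constructor <;> simp only [Set.mem_insert_iff, reduceCtorEq, false_or, neg.injEq]
    · exact hV.atom
    · rintro ψ (rfl | h)
      · exact .inr hφ
      · exact .inr (hV.neg ψ h)
    · exact fun α β h => ⟨.inr (hV.and α β h).1, .inr (hV.and α β h).2⟩
    · exact fun X α h => ⟨(hV.dmod X α h).1, .inr (hV.dmod X α h).2⟩
    · exact fun X α h => ⟨(hV.kmod X α h).1, .inr (hV.kmod X α h).2⟩
    · exact hV.ddep
    · exact hV.kdep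
  | and φ ψ ih₁ ih₂ =>
    obtain ⟨V₁, S₁, hS₁, hV₁, hφ₁⟩ := ih₁
    obtain ⟨V₂, S₂, hS₂, hV₂, hφ₂⟩ := ih₂
    have hV := hV₁.union hV₂
    refine ⟨V₁ ∪ V₂, insert (.and φ ψ) (S₁ ∪ S₂), (hS₁.union hS₂).insert _, ?_,
      Set.mem_insert _ _⟩
    constructor <;> simp only [Set.mem_insert_iff, reduceCtorEq, false_or, and.injEq]
    · exact hV.atom
    · exact fun α h => .inr (hV.neg α h)
    · rintro α β (⟨rfl, rfl⟩ | h)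
      · exact ⟨.inr (.inl hφ₁), .inr (.inr hφ₂)⟩
      · exact ⟨.inr (hV.and α β h).1, .inr (hV.and α β h).2⟩
    · exact fun X α h => ⟨(hV.dmod X α h).1, .inr (hV.dmod X α h).2⟩
    · exact fun X α h => ⟨(hV.kmod X α h).1, .inr (hV.kmod X α h).2⟩
    · exact hV.ddep
    · exact hV.kdep
  | dmod Y φ ih =>
    obtain ⟨V, S, hS, hV, hφ⟩ := ih
    replace hV : IsClosedUnder (V ∪ Y) S := by
      simpa using hV.union (V' := Y) (S' := ∅) (by constructor <;> simp)
    refine ⟨V ∪ Y, insert (.dmod Y φ) S, hS.insert _, ?_, Set.mem_insert _ _⟩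
    constructor <;> simp only [Set.mem_insert_iff, reduceCtorEq, false_or, dmod.injEq]
    · exact hV.atom
    · exact fun α h => .inr (hV.neg α h)
    · exact fun α β h => ⟨.inr (hV.and α β h).1, .inr (hV.and α β h).2⟩
    · rintro X ψ (⟨rfl, rfl⟩ | h)
      · exact ⟨Finset.subset_union_right, .inr hφ⟩
      · exact ⟨(hV.dmod X ψ h).1, .inr (hV.dmod X ψ h).2⟩
    · exact fun X α h => ⟨(hV.kmod X α h).1, .inr (hV.kmod X α h).2⟩
    · exact hV.ddep
    · exact hV.kdep
  | kmod Y φ ih =>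
    obtain ⟨V, S, hS, hV, hφ⟩ := ih
    replace hV : IsClosedUnder (V ∪ Y) S := by
      simpa using hV.union (V' := Y) (S' := ∅) (by constructor <;> simp)
    refine ⟨V ∪ Y, insert (.kmod Y φ) S, hS.insert _, ?_, Set.mem_insert _ _⟩
    constructor <;> simp only [Set.mem_insert_iff, reduceCtorEq, false_or, kmod.injEq]
    · exact hV.atom
    · exact fun α h => .inr (hV.neg α h)
    · exact fun α β h => ⟨.inr (hV.and α β h).1, .inr (hV.and α β h).2⟩
    · exact fun X α h => ⟨(hV.dmod X α h).1, .inr (hV.dmod X α h).2⟩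
    · rintro X ψ (⟨rfl, rfl⟩ | h)
      · exact ⟨Finset.subset_union_right, .inr hφ⟩
      · exact ⟨(hV.kmod X ψ h).1, .inr (hV.kmod X ψ h).2⟩
    · exact hV.ddep
    · exact hV.kdep
  | ddep X Y =>
    refine ⟨X ∪ Y, {.ddep X Y}, Set.finite_singleton _, ?_, rfl⟩
    constructor <;> simp
  | kdep X Y =>
    refine ⟨X ∪ Y, {.kdep X Y}, Set.finite_singleton _, ?_, rfl⟩
    constructor <;> simp

/-- An unprovable formula is refuted in a pseudo-locally Lipschitz metric model. -/
theorem exists_metricDepModel_of_not_provable {φ : Formula Var Pred ar} (hφ : ¬ Provable φ) :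
    ∃ H : MetricDepModel.{u, v, w, w'} Var Pred ar, H.IsPseudoLocallyLipschitz ∧
      ¬ H.toTopoDepModel.GloballyTrue φ := by
  obtain ⟨V, S, hS, hV, hφS⟩ := exists_isClosedUnder φ
  lift S to Finset (Formula Var Pred ar) using hS
  obtain ⟨M, a, ha⟩ := exists_premodel_of_card hV le_rfl hφS hφ
  exact M.exists_metricDepModel hV hφS ha

theorem provable_iff_validTopo (φ : Formula Var Pred ar) :
    Provable φ ↔ ValidTopo.{u, v, w, w'} φ := by
  refine ⟨fun h M s => M.soundness h s, fun h => ?_⟩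
  by_contra hφ
  obtain ⟨H, -, hH⟩ := exists_metricDepModel_of_not_provable.{u, v, w, w'} hφ
  exact hH (h _)

theorem provable_iff_validMetric (φ : Formula Var Pred ar) :
    Provable φ ↔ ValidMetric.{u, v, w, w'} φ := by
  refine ⟨fun h M s => M.toTopoDepModel.soundness h s, fun h => ?_⟩
  by_contra hφ
  obtain ⟨H, -, hH⟩ := exists_metricDepModel_of_not_provable.{u, v, w, w'} hφ
  exact hH (h H)

theorem provable_iff_validConcrete (φ : Formula Var Pred ar) :
    Provable φ ↔ ValidConcrete.{u, v, w} φ := by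
  refine ⟨fun h M s => M.toTopoDepModel.soundness h s, fun h => ?_⟩
  by_contra hφ
  obtain ⟨H, -, hH⟩ := exists_metricDepModel_of_not_provable.{u, v, w, 0} hφ
  exact hH fun s => (H.toTopoDepModel.sat_toConcrete φ s).1 (h _ _)

theorem provable_iff_validPseudoLocallyLipschitz (φ : Formula Var Pred ar) :
    Provable φ ↔ ValidPseudoLocallyLipschitz.{u, v, w, w'} φ := by
  refine ⟨fun h M _ s => M.toTopoDepModel.soundness h s, fun h => ?_⟩
  by_contra hφ
  obtain ⟨H, hL, hH⟩ := exists_metricDepModel_of_not_provable.{u, v, w, w'} hφ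
  exact hH (h H hL)

/-! ### Premodels coded by natural numbers -/

/-- The bits of `X` below `b` are the members of the list coded by `l`. -/
def IsBitsetOf (b X l : ℕ) : Prop :=
  ∀ y < b, X.testBit y = true ↔ y ∈ Denumerable.ofNat (List ℕ) l

/-- The relations `Q 0` (equality), `Q 1` (closeness), `Q 2` and `Q 3` (dependence) on the states
below `N`, the variables below `b` and the sets of variables coded by the bits of the numbers below
`P` satisfy the relational conditions of a premodel. -/
def IsNatFrame (b N P : ℕ) (Q : ℕ → ℕ → ℕ → ℕ → Prop) : Prop :=
  (∀ X < P, ∀ i < N, Q 0 X i i) ∧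
  (∀ X < P, ∀ i < N, ∀ j < N, Q 0 X i j → Q 0 X j i) ∧
  (∀ X < P, ∀ i < N, ∀ j < N, ∀ k < N, Q 0 X i j → Q 0 X j k → Q 0 X i k) ∧
  (∀ X < P, ∀ i < N, ∀ j < N, Q 0 X i j → Q 1 X i j) ∧
  (∀ i < N, ∀ j < N, Q 0 0 i j) ∧
  (∀ X < P, ∀ i < N, ∀ j < N, ∀ k < N, Q 1 X i j → Q 1 X j k → Q 1 X i k) ∧
  (∀ X < P, ∀ i < N, ∀ y < b, X.testBit y = true → Q 2 i X y) ∧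
  (∀ X < P, ∀ Y < P, ∀ i < N, ∀ z < b,
    (∀ y < b, Y.testBit y = true → Q 2 i X y) → Q 2 i Y z → Q 2 i X z) ∧
  (∀ X < P, ∀ i < N, ∀ j < N, ∀ y < b, Q 0 X i j → Q 2 i X y → Q 2 j X y) ∧
  (∀ X < P, ∀ Y < P, ∀ i < N, ∀ j < N,
    (∀ y < b, Y.testBit y = true → Q 2 i X y) → Q 0 X i j → Q 0 Y i j) ∧
  (∀ X < P, ∀ i < N, ∀ y < b, X.testBit y = true → Q 3 i X y) ∧
  (∀ X < P, ∀ Y < P, ∀ i < N, ∀ z < b,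
    (∀ y < b, Y.testBit y = true → Q 3 i X y) → Q 3 i Y z → Q 3 i X z) ∧
  (∀ X < P, ∀ i < N, ∀ j < N, ∀ y < b, Q 1 X i j → Q 3 i X y → Q 3 j X y) ∧
  (∀ X < P, ∀ Y < P, ∀ i < N, ∀ j < N,
    (∀ y < b, Y.testBit y = true → Q 3 i X y) → Q 1 X i j → Q 1 Y i j) ∧
  (∀ X < P, ∀ i < N, ∀ y < b, Q 3 i X y → Q 2 i X y) ∧
  (∀ i < N, ∀ y < b, Q 2 i 0 y → Q 3 i 0 y)

/-- The truth relation `Q 4` satisfies the clauses of a premodel for the formula coded by `c`, with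
immediate subformulas among those marked by `Q 5`. -/
def IsNatTruth (b N P c : ℕ) (Q : ℕ → ℕ → ℕ → ℕ → Prop) : Prop :=
  (∀ p < b, ∀ l < b, c = Nat.pair 0 (Nat.pair p l) → ∀ X < P, IsBitsetOf b X l →
    ∀ i < N, ∀ j < N, Q 0 X i j → Q 4 i c 0 → Q 4 j c 0) ∧
  (∀ d < b, c = Nat.pair 1 d → Q 5 d 0 0 ∧ ∀ i < N, (Q 4 i c 0 ↔ ¬ Q 4 i d 0)) ∧
  (∀ d < b, ∀ e < b, c = Nat.pair 2 (Nat.pair d e) → (Q 5 d 0 0 ∧ Q 5 e 0 0) ∧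
    ∀ i < N, (Q 4 i c 0 ↔ (Q 4 i d 0 ∧ Q 4 i e 0))) ∧
  (∀ l < b, ∀ d < b, c = Nat.pair 3 (Nat.pair l d) → Q 5 d 0 0 ∧ ∀ X < P, IsBitsetOf b X l →
    ∀ i < N, (Q 4 i c 0 ↔ ∀ j < N, Q 0 X i j → Q 4 j d 0)) ∧
  (∀ l < b, ∀ d < b, c = Nat.pair 4 (Nat.pair l d) → Q 5 d 0 0 ∧ ∀ X < P, IsBitsetOf b X l →
    ∀ i < N, (Q 4 i c 0 ↔ ∀ j < N, Q 1 X i j → Q 4 j d 0)) ∧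
  (∀ l < b, ∀ k < b, c = Nat.pair 5 (Nat.pair l k) → ∀ X < P, IsBitsetOf b X l →
    ∀ i < N, (Q 4 i c 0 ↔ ∀ y < b, y ∈ Denumerable.ofNat (List ℕ) k → Q 2 i X y)) ∧
  (∀ l < b, ∀ k < b, c = Nat.pair 6 (Nat.pair l k) → ∀ X < P, IsBitsetOf b X l →
    ∀ i < N, (Q 4 i c 0 ↔ ∀ y < b, y ∈ Denumerable.ofNat (List ℕ) k → Q 3 i X y))

/-- `Q` codes a premodel that refutes the formula coded by `n`. -/
def NatRefutes (n b N P : ℕ) (Q : ℕ → ℕ → ℕ → ℕ → Prop) : Prop :=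
  IsNatFrame b N P Q ∧ (∀ c < b, Q 5 c 0 0 → IsNatTruth b N P c Q) ∧ Q 5 n 0 0 ∧
    ∃ i < N, ¬ Q 4 i n 0

/-- The relation read off from the bits of a number. -/
def bitRel (m k x y z : ℕ) : Prop :=
  m.testBit (Nat.pair k (Nat.pair x (Nat.pair y z))) = true

/-- A bound on the number of states of a premodel for a formula with code less than `b`. -/
def stateBound (b : ℕ) : ℕ := 2 ^ (b + 2 * (2 ^ b * b))

/-- A bound on the positions of the bits that code a premodel. -/
def bitBound (b : ℕ) : ℕ :=
  Nat.pair 6 (Nat.pair (stateBound b + 2 ^ b + b)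
    (Nat.pair (stateBound b + 2 ^ b + b) (stateBound b + 2 ^ b + b)))

/-! ### Computability -/

section Primrec

variable {α : Type*} [Primcodable α]

theorem primrecPred_forall_lt {p : α → ℕ → Prop} {f : α → ℕ} (hf : Primrec f)
    (hp : PrimrecPred fun q : α × ℕ => p q.1 q.2) : PrimrecPred fun a => ∀ x < f a, p a x :=
  ((PrimrecRel.forall_mem_list (R := fun x a => p a x)
    (hp.comp (Primrec.pair Primrec.snd Primrec.fst))).comp
      (Primrec.list_range.comp hf) Primrec.id).of_eq fun _ => by simp

theorem primrecPred_exists_lt {p : α → ℕ → Prop} {f : α → ℕ} (hf : Primrec f)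
    (hp : PrimrecPred fun q : α × ℕ => p q.1 q.2) : PrimrecPred fun a => ∃ x < f a, p a x :=
  ((PrimrecRel.exists_mem_list (R := fun x a => p a x)
    (hp.comp (Primrec.pair Primrec.snd Primrec.fst))).comp
      (Primrec.list_range.comp hf) Primrec.id).of_eq fun _ => by simp

theorem primrecPred_imp {p q : α → Prop} (hp : PrimrecPred p) (hq : PrimrecPred q) :
    PrimrecPred fun a => p a → q a :=
  (hp.not.or hq).of_eq fun _ => imp_iff_not_or.symm

theorem primrecPred_iff {p q : α → Prop} (hp : PrimrecPred p) (hq : PrimrecPred q) :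
    PrimrecPred fun a => p a ↔ q a :=
  ((primrecPred_imp hp hq).and (primrecPred_imp hq hp)).of_eq fun _ => iff_def.symm

theorem primrecPred_eq {f g : α → ℕ} (hf : Primrec f) (hg : Primrec g) :
    PrimrecPred fun a => f a = g a :=
  Primrec.eq.comp hf hg

theorem primrec_two_pow {f : α → ℕ} (hf : Primrec f) : Primrec fun a => 2 ^ f a :=
  (Primrec₂.unpaired'.1 Nat.Primrec.pow).comp (Primrec.const 2) hf

theorem primrecPred_testBit {f g : α → ℕ} (hf : Primrec f) (hg : Primrec g) :
    PrimrecPred fun a => (f a).testBit (g a) = true :=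
  (primrecPred_eq (Primrec.nat_mod.comp (Primrec.nat_div.comp hf (primrec_two_pow hg))
    (Primrec.const 2)) (Primrec.const 1)).of_eq fun a => by
      rw [Nat.testBit_eq_decide_div_mod_eq, decide_eq_true_iff]

theorem primrecPred_mem_ofNat {f g : α → ℕ} (hf : Primrec f) (hg : Primrec g) :
    PrimrecPred fun a => f a ∈ Denumerable.ofNat (List ℕ) (g a) :=
  ((PrimrecRel.exists_mem_list (R := fun x y : ℕ => x = y) Primrec.eq).comp
    ((Primrec.ofNat (List ℕ)).comp hg) hf).of_eq fun a => by simp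

theorem primrec_natPair {f g : α → ℕ} (hf : Primrec f) (hg : Primrec g) :
    Primrec fun a => Nat.pair (f a) (g a) :=
  Primrec₂.natPair.comp hf hg

theorem primrec_add {f g : α → ℕ} (hf : Primrec f) (hg : Primrec g) :
    Primrec fun a => f a + g a :=
  Primrec.nat_add.comp hf hg

theorem primrec_mul {f g : α → ℕ} (hf : Primrec f) (hg : Primrec g) :
    Primrec fun a => f a * g a :=
  Primrec.nat_mul.comp hf hg

theorem primrec_fun_id : Primrec fun a : α => a :=
  Primrec.id

theorem primrec_fst_comp {β γ : Type*} [Primcodable β] [Primcodable γ] {f : α → β × γ}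
    (hf : Primrec f) : Primrec fun a => (f a).1 :=
  Primrec.fst.comp hf

theorem primrec_snd_comp {β γ : Type*} [Primcodable β] [Primcodable γ] {f : α → β × γ}
    (hf : Primrec f) : Primrec fun a => (f a).2 :=
  Primrec.snd.comp hf

theorem primrecPred_bitRel {f g₁ g₂ g₃ : α → ℕ} (k : ℕ) (hf : Primrec f) (h₁ : Primrec g₁)
    (h₂ : Primrec g₂) (h₃ : Primrec g₃) :
    PrimrecPred fun a => bitRel (f a) k (g₁ a) (g₂ a) (g₃ a) :=
  primrecPred_testBit hf (primrec_natPair (Primrec.const k)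
    (primrec_natPair h₁ (primrec_natPair h₂ h₃)))

theorem primrecPred_isBitsetOf {b X l : α → ℕ} (hb : Primrec b) (hX : Primrec X)
    (hl : Primrec l) : PrimrecPred fun a => IsBitsetOf (b a) (X a) (l a) :=
  primrecPred_forall_lt hb (primrecPred_iff
    (primrecPred_testBit (hX.comp Primrec.fst) Primrec.snd)
    (primrecPred_mem_ofNat Primrec.snd (hl.comp Primrec.fst)))

end Primrec

/-- All quantifiers are bounded and the matrix tests bits, so a syntax-directed search through the
closure properties succeeds. -/
theorem primrecPred_isNatFrame : PrimrecPred fun q : ((ℕ × ℕ) × ℕ) × ℕ =>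
    IsNatFrame q.1.1.2 q.1.2 q.2 (bitRel q.1.1.1) := by
  unfold IsNatFrame
  repeat' with_reducible first
    | apply PrimrecPred.and
    | apply PrimrecPred.not
    | apply primrecPred_forall_lt
    | apply primrecPred_bitRel
    | apply primrecPred_testBit
    | apply primrecPred_isBitsetOf
    | apply primrecPred_mem_ofNat
    | apply primrecPred_eq
    | apply primrecPred_iff
    | apply primrecPred_imp
    | exact Primrec.const _
    | exact primrec_fun_id
    | apply primrec_fst_comp
    | apply primrec_snd_comp

theorem primrecPred_isNatTruth : PrimrecPred fun q : (((ℕ × ℕ) × ℕ) × ℕ) × ℕ =>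
    IsNatTruth q.1.1.1.2 q.1.1.2 q.1.2 q.2 (bitRel q.1.1.1.1) := by
  unfold IsNatTruth
  repeat' with_reducible first
    | apply PrimrecPred.and
    | apply PrimrecPred.not
    | apply primrecPred_forall_lt
    | apply primrecPred_bitRel
    | apply primrecPred_testBit
    | apply primrecPred_isBitsetOf
    | apply primrecPred_mem_ofNat
    | apply primrecPred_eq
    | apply primrecPred_iff
    | apply primrecPred_imp
    | exact Primrec.const _
    | exact primrec_fun_id
    | apply primrec_fst_comp
    | apply primrec_snd_comp
    | apply primrec_natPair

theorem primrec_stateBound {α : Type*} [Primcodable α] {f : α → ℕ} (hf : Primrec f) :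
    Primrec fun a => stateBound (f a) :=
  primrec_two_pow (primrec_add hf (primrec_mul (Primrec.const 2)
    (primrec_mul (primrec_two_pow hf) hf)))

theorem primrec_bitBound {α : Type*} [Primcodable α] {f : α → ℕ} (hf : Primrec f) :
    Primrec fun a => bitBound (f a) := by
  have h : Primrec fun a => stateBound (f a) + 2 ^ f a + f a :=
    primrec_add (primrec_add (primrec_stateBound hf) (primrec_two_pow hf)) hf
  exact primrec_natPair (Primrec.const 6) (primrec_natPair h (primrec_natPair h h))

theorem primrecPred_natRefutes : PrimrecPred fun q : ℕ × ℕ =>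
    NatRefutes q.1 (q.1 + 1) (stateBound (q.1 + 1)) (2 ^ (q.1 + 1)) (bitRel q.2) := by
  have hb : Primrec fun q : ℕ × ℕ => q.1 + 1 := Primrec.succ.comp Primrec.fst
  have hN := primrec_stateBound hb
  have hP := primrec_two_pow hb
  have hq : Primrec fun q : ℕ × ℕ =>
      (((q.2, q.1 + 1), stateBound (q.1 + 1)), 2 ^ (q.1 + 1)) :=
    ((Primrec.snd.pair hb).pair hN).pair hP
  refine (primrecPred_isNatFrame.comp hq).and (PrimrecPred.and ?_ (PrimrecPred.and ?_ ?_))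
  · refine primrecPred_forall_lt hb (primrecPred_imp ?_ ?_)
    · exact primrecPred_bitRel 5 (Primrec.snd.comp Primrec.fst) Primrec.snd (Primrec.const 0)
        (Primrec.const 0)
    · exact primrecPred_isNatTruth.comp ((hq.comp Primrec.fst).pair Primrec.snd)
  · exact primrecPred_bitRel 5 Primrec.snd Primrec.fst (Primrec.const 0) (Primrec.const 0)
  · exact primrecPred_exists_lt hN (primrecPred_bitRel 4 (Primrec.snd.comp Primrec.fst)
      Primrec.snd (Primrec.fst.comp Primrec.fst) (Primrec.const 0)).not

theorem primrecPred_exists_natRefutes : PrimrecPred fun n : ℕ => ∃ m < 2 ^ bitBound (n + 1),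
    NatRefutes n (n + 1) (stateBound (n + 1)) (2 ^ (n + 1)) (bitRel m) :=
  primrecPred_exists_lt (primrec_two_pow (primrec_bitBound Primrec.succ)) primrecPred_natRefutes

/-! ### Decoding -/

section Encoding

variable {Var : Type u} [Encodable Var]

/-- The checker can thus read a list of variables as a list of numbers, without decoding variables.
-/
theorem encode_list_eq (L : List Var) :
    Encodable.encode L = Encodable.encode (L.map Encodable.encode : List ℕ) := by
  induction L with
  | nil => rfl
  | cons x L ih =>
    rw [List.map_cons, Encodable.encode_list_cons, Encodable.encode_list_cons, ih]
    rfl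

theorem mem_ofNat_encode_list {L : List Var} {y : ℕ} :
    y ∈ Denumerable.ofNat (List ℕ) (Encodable.encode L) ↔ ∃ x ∈ L, Encodable.encode x = y := by
  rw [encode_list_eq, Denumerable.ofNat_encode, List.mem_map]

theorem encode_lt_encode_list {L : List Var} {x : Var} (hx : x ∈ L) :
    Encodable.encode x < Encodable.encode L := by
  induction L with
  | nil => simp at hx
  | cons a L ih =>
    rw [Encodable.encode_list_cons]
    rcases List.mem_cons.1 hx with rfl | hx
    · exact Nat.lt_succ_of_le (Nat.left_le_pair _ _)
    · exact (ih hx).trans_le ((Nat.right_le_pair _ _).trans (Nat.le_succ _))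

theorem exists_list_encode_finset (X : Finset Var) :
    ∃ L : List Var, Encodable.encode X = Encodable.encode L ∧ ∀ x, x ∈ L ↔ x ∈ X := by
  refine ⟨_, rfl, fun x => ?_⟩
  simp

theorem mem_ofNat_encode_finset {X : Finset Var} {y : ℕ} :
    y ∈ Denumerable.ofNat (List ℕ) (Encodable.encode X) ↔ ∃ x ∈ X, Encodable.encode x = y := by
  obtain ⟨L, hL, hX⟩ := exists_list_encode_finset X
  simp [hL, mem_ofNat_encode_list, hX]

theorem encode_lt_encode_finset {X : Finset Var} {x : Var} (hx : x ∈ X) :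
    Encodable.encode x < Encodable.encode X := by
  obtain ⟨L, hL, hX⟩ := exists_list_encode_finset X
  rw [hL]
  exact encode_lt_encode_list ((hX x).2 hx)

/-- The variables with code less than `b`. -/
noncomputable def varsBelow (Var : Type u) [Encodable Var] (b : ℕ) : Finset Var :=
  (Finset.range b).preimage Encodable.encode Encodable.encode_injective.injOn

theorem mem_varsBelow {b : ℕ} {x : Var} : x ∈ varsBelow Var b ↔ Encodable.encode x < b := by
  simp [varsBelow]

theorem mem_varsBelow_of_encode_eq {b y : ℕ} {x : Var} (hy : y < b) (hx : Encodable.encode x = y) :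
    x ∈ varsBelow Var b :=
  mem_varsBelow.2 (hx ▸ hy)

theorem card_varsBelow_le (b : ℕ) : (varsBelow Var b).card ≤ b := by
  have := Finset.card_le_card_of_injOn (s := varsBelow Var b) (t := Finset.range b)
    Encodable.encode (fun x hx => by simpa [mem_varsBelow] using hx)
    Encodable.encode_injective.injOn
  simpa using this

/-- The set of variables below `b` coded by the bits of `X`. -/
noncomputable def ofBitset (Var : Type u) [Encodable Var] (b X : ℕ) : Finset Var :=
  (varsBelow Var b).filter fun x => X.testBit (Encodable.encode x) = true

theorem mem_ofBitset {b X : ℕ} {x : Var} :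
    x ∈ ofBitset Var b X ↔ Encodable.encode x < b ∧ X.testBit (Encodable.encode x) = true := by
  simp [ofBitset, mem_varsBelow]

theorem ofBitset_subset {b X : ℕ} : ofBitset Var b X ⊆ varsBelow Var b :=
  Finset.filter_subset _ _

theorem ofBitset_zero {b : ℕ} : ofBitset Var b 0 = ∅ := by
  ext x
  simp [mem_ofBitset]

theorem ofBitset_eq_of_isBitsetOf {b X l : ℕ} {Y : Finset Var} (hY : Y ⊆ varsBelow Var b)
    (hl : ∀ y, y ∈ Denumerable.ofNat (List ℕ) l ↔ ∃ x ∈ Y, Encodable.encode x = y)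
    (h : IsBitsetOf b X l) : ofBitset Var b X = Y := by
  ext x
  rw [mem_ofBitset]
  constructor
  · rintro ⟨h₁, h₂⟩
    obtain ⟨x', hx', he⟩ := (hl _).1 ((h _ h₁).1 h₂)
    rwa [← Encodable.encode_injective he]
  · intro hx
    have hb := mem_varsBelow.1 (hY hx)
    exact ⟨hb, (h _ hb).2 ((hl _).2 ⟨x, hx, rfl⟩)⟩

theorem exists_testBit_iff (B : ℕ) (p : ℕ → Prop) :
    ∃ m < 2 ^ B, ∀ k, m.testBit k = true ↔ k < B ∧ p k := by
  classical
  refine ⟨Nat.ofBits fun i : Fin B => decide (p i), Nat.ofBits_lt_two_pow _, fun k => ?_⟩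
  by_cases hk : k < B
  · simp [Nat.testBit_ofBits_lt _ _ hk, hk]
  · simp [Nat.testBit_ofBits_ge _ _ (not_lt.1 hk), hk]

/-- The number whose bits below `b` are the codes of the members of `X`. -/
noncomputable def toBitset (b : ℕ) (X : Finset Var) : ℕ :=
  (exists_testBit_iff b fun k => ∃ x ∈ X, Encodable.encode x = k).choose

theorem toBitset_lt (b : ℕ) (X : Finset Var) : toBitset b X < 2 ^ b :=
  (exists_testBit_iff b fun k => ∃ x ∈ X, Encodable.encode x = k).choose_spec.1

theorem testBit_toBitset {b : ℕ} {X : Finset Var} {k : ℕ} :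
    (toBitset b X).testBit k = true ↔ k < b ∧ ∃ x ∈ X, Encodable.encode x = k :=
  (exists_testBit_iff b fun k => ∃ x ∈ X, Encodable.encode x = k).choose_spec.2 k

theorem toBitset_empty (b : ℕ) : toBitset b (∅ : Finset Var) = 0 := by
  refine Nat.eq_of_testBit_eq fun k => ?_
  rw [Nat.zero_testBit, Bool.eq_false_iff]
  intro h
  obtain ⟨-, x, hx, -⟩ := testBit_toBitset.1 h
  exact absurd hx (Finset.notMem_empty x)

theorem isBitsetOf_toBitset {b l : ℕ} {X : Finset Var}
    (hl : ∀ y, y ∈ Denumerable.ofNat (List ℕ) l ↔ ∃ x ∈ X, Encodable.encode x = y) :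
    IsBitsetOf b (toBitset b X) l := by
  intro y hy
  rw [testBit_toBitset, hl]
  exact and_iff_right hy

theorem forall_testBit_toBitset {b : ℕ} {p : ℕ → Prop} {Y : Finset Var}
    (h : ∀ y ∈ Y, p (Encodable.encode y)) : ∀ y < b, (toBitset b Y).testBit y = true → p y := by
  intro y _ hy
  obtain ⟨-, x, hx, rfl⟩ := testBit_toBitset.1 hy
  exact h x hx

end Encoding

/-! ### Codes of formulas and the formulas below a bound. -/

section Code

variable {Var : Type u} {Pred : Type v} {ar : Pred → ℕ} [Encodable Var] [Encodable Pred]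

theorem code_injective : Function.Injective (code (Var := Var) (Pred := Pred) (ar := ar)) := by
  intro φ
  induction φ with
  | atom P xs =>
    intro ψ h
    cases ψ <;> simp only [code, Nat.pair_eq_pair] at h <;> try omega
    obtain ⟨-, h₁, h₂⟩ := h
    obtain rfl := Encodable.encode_injective h₁
    rw [List.ofFn_injective (Encodable.encode_injective h₂)]
  | neg φ ih =>
    intro ψ h
    cases ψ <;> simp only [code, Nat.pair_eq_pair] at h <;> try omega
    rw [ih h.2]
  | and φ φ' ih ih' =>
    intro ψ h
    cases ψ <;> simp only [code, Nat.pair_eq_pair] at h <;> try omega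
    rw [ih h.2.1, ih' h.2.2]
  | dmod X φ ih =>
    intro ψ h
    cases ψ <;> simp only [code, Nat.pair_eq_pair] at h <;> try omega
    rw [Encodable.encode_injective h.2.1, ih h.2.2]
  | kmod X φ ih =>
    intro ψ h
    cases ψ <;> simp only [code, Nat.pair_eq_pair] at h <;> try omega
    rw [Encodable.encode_injective h.2.1, ih h.2.2]
  | ddep X Y =>
    intro ψ h
    cases ψ <;> simp only [code, Nat.pair_eq_pair] at h <;> try omega
    rw [Encodable.encode_injective h.2.1, Encodable.encode_injective h.2.2]
  | kdep X Y =>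
    intro ψ h
    cases ψ <;> simp only [code, Nat.pair_eq_pair] at h <;> try omega
    rw [Encodable.encode_injective h.2.1, Encodable.encode_injective h.2.2]

theorem lt_of_pair_lt {k x b : ℕ} (h : Nat.pair k x < b) : x < b :=
  (Nat.right_le_pair k x).trans_lt h

theorem lt_and_lt_of_pair_lt {x y b : ℕ} (h : Nat.pair x y < b) : x < b ∧ y < b :=
  ⟨(Nat.left_le_pair x y).trans_lt h, (Nat.right_le_pair x y).trans_lt h⟩

theorem subset_varsBelow {b : ℕ} {X : Finset Var} (h : Encodable.encode X < b) :
    X ⊆ varsBelow Var b :=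
  fun _ hx => mem_varsBelow.2 ((encode_lt_encode_finset hx).trans h)

theorem mem_ofNat_encode_ofFn [DecidableEq Var] {n : ℕ} {xs : Fin n → Var} {y : ℕ} :
    y ∈ Denumerable.ofNat (List ℕ) (Encodable.encode (List.ofFn xs)) ↔
      ∃ x ∈ Finset.univ.image xs, Encodable.encode x = y := by
  simp [mem_ofNat_encode_list, List.mem_ofFn]

/-- The formulas with code less than `b`. -/
noncomputable def formulasBelow (Var : Type u) (Pred : Type v) (ar : Pred → ℕ) [Encodable Var]
    [Encodable Pred] (b : ℕ) : Finset (Formula Var Pred ar) :=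
  (Finset.range b).preimage code code_injective.injOn

theorem mem_formulasBelow {b : ℕ} {φ : Formula Var Pred ar} :
    φ ∈ formulasBelow Var Pred ar b ↔ φ.code < b := by
  simp [formulasBelow]

theorem card_formulasBelow_le (b : ℕ) : (formulasBelow Var Pred ar b).card ≤ b := by
  have := Finset.card_le_card_of_injOn (s := formulasBelow Var Pred ar b) (t := Finset.range b)
    code (fun x hx => by simpa [mem_formulasBelow] using hx) code_injective.injOn
  simpa using this

variable [DecidableEq Var]

theorem image_subset_varsBelow {b n : ℕ} {xs : Fin n → Var}
    (h : Encodable.encode (List.ofFn xs) < b) : Finset.univ.image xs ⊆ varsBelow Var b := by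
  intro x hx
  obtain ⟨i, -, rfl⟩ := Finset.mem_image.1 hx
  exact mem_varsBelow.2 ((encode_lt_encode_list (by simp)).trans h)

theorem isClosedUnder_formulasBelow (b : ℕ) : IsClosedUnder (varsBelow Var b)
    (formulasBelow Var Pred ar b : Set (Formula Var Pred ar)) := by
  constructor <;> simp only [Finset.mem_coe, mem_formulasBelow, code]
  · exact fun P xs h => image_subset_varsBelow (lt_of_pair_lt (lt_of_pair_lt h))
  · exact fun φ h => lt_of_pair_lt h
  · exact fun φ ψ h => lt_and_lt_of_pair_lt (lt_of_pair_lt h)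
  · exact fun X φ h => (lt_and_lt_of_pair_lt (lt_of_pair_lt h)).imp subset_varsBelow id
  · exact fun X φ h => (lt_and_lt_of_pair_lt (lt_of_pair_lt h)).imp subset_varsBelow id
  · exact fun X Y h =>
      (lt_and_lt_of_pair_lt (lt_of_pair_lt h)).imp subset_varsBelow subset_varsBelow
  · exact fun X Y h =>
      (lt_and_lt_of_pair_lt (lt_of_pair_lt h)).imp subset_varsBelow subset_varsBelow

end Code

variable {Var : Type u} {Pred : Type v} {ar : Pred → ℕ} [DecidableEq Var] [Encodable Var]
  [Encodable Pred]

/-! ### Coded and abstract premodels -/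

/-! ### From a coded premodel to a countermodel. -/

section OfCode

variable {b N : ℕ} {Q : ℕ → ℕ → ℕ → ℕ → Prop}

/-- The formulas marked by a coded premodel. -/
def markedFormulas (Var : Type u) (Pred : Type v) (ar : Pred → ℕ) [Encodable Var]
    [Encodable Pred] (b : ℕ) (Q : ℕ → ℕ → ℕ → ℕ → Prop) : Set (Formula Var Pred ar) :=
  {φ | φ.code < b ∧ Q 5 φ.code 0 0}

/-- Closure comes from the marks that the truth clauses demand of immediate subformulas. Marks are
part of the searched data because arities and encodings need not be computable: the checker never
decides which numbers code formulas. -/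
theorem isClosedUnder_markedFormulas
    (hT : ∀ c < b, Q 5 c 0 0 → IsNatTruth b N (2 ^ b) c Q) :
    IsClosedUnder (varsBelow Var b) (markedFormulas Var Pred ar b Q) := by
  have hcl := isClosedUnder_formulasBelow (Var := Var) (Pred := Pred) (ar := ar) b
  have hmem : ∀ {φ : Formula Var Pred ar}, φ ∈ markedFormulas Var Pred ar b Q →
      φ ∈ (formulasBelow Var Pred ar b : Set (Formula Var Pred ar)) :=
    fun h => mem_formulasBelow.2 h.1
  have hlt : ∀ {φ : Formula Var Pred ar},
      φ ∈ (formulasBelow Var Pred ar b : Set (Formula Var Pred ar)) → φ.code < b :=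
    fun h => mem_formulasBelow.1 h
  constructor
  · exact fun P xs h => hcl.atom P xs (hmem h)
  · intro φ h
    have h₁ := hlt (hcl.neg φ (hmem h))
    exact ⟨h₁, ((hT _ h.1 h.2).2.1 _ h₁ rfl).1⟩
  · intro φ ψ h
    have h₁ := hlt (hcl.and φ ψ (hmem h)).1
    have h₂ := hlt (hcl.and φ ψ (hmem h)).2
    have h₃ := ((hT _ h.1 h.2).2.2.1 _ h₁ _ h₂ rfl).1
    exact ⟨⟨h₁, h₃.1⟩, h₂, h₃.2⟩
  · intro X φ h
    have h₁ := hcl.dmod X φ (hmem h)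
    have h₂ := hlt h₁.2
    refine ⟨h₁.1, h₂, ((hT _ h.1 h.2).2.2.2.1 _ ?_ _ h₂ rfl).1⟩
    exact (lt_and_lt_of_pair_lt (lt_of_pair_lt h.1)).1
  · intro X φ h
    have h₁ := hcl.kmod X φ (hmem h)
    have h₂ := hlt h₁.2
    refine ⟨h₁.1, h₂, ((hT _ h.1 h.2).2.2.2.2.1 _ ?_ _ h₂ rfl).1⟩
    exact (lt_and_lt_of_pair_lt (lt_of_pair_lt h.1)).1
  · exact fun X Y h => hcl.ddep X Y (hmem h)
  · exact fun X Y h => hcl.kdep X Y (hmem h)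

/-- The premodel coded by `Q`. -/
noncomputable def premodelOfCode (hF : IsNatFrame b N (2 ^ b) Q)
    (hT : ∀ c < b, Q 5 c 0 0 → IsNatTruth b N (2 ^ b) c Q) :
    Premodel (varsBelow Var b) (markedFormulas Var Pred ar b Q) (Fin N) where
  tr i φ := Q 4 i φ.code 0
  dD i X y := Q 2 i (toBitset b X) (Encodable.encode y)
  dK i X y := Q 3 i (toBitset b X) (Encodable.encode y)
  eqv X i j := Q 0 (toBitset b X) i j
  le X i j := Q 1 (toBitset b X) i j
  eqv_refl {X} i _ := hF.1 _ (toBitset_lt b X) i i.2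
  eqv_symm {X i j} _ := hF.2.1 _ (toBitset_lt b X) i i.2 j j.2
  eqv_trans {X i j k} _ := hF.2.2.1 _ (toBitset_lt b X) i i.2 j j.2 k k.2
  eqv_le {X i j} _ := hF.2.2.2.1 _ (toBitset_lt b X) i i.2 j j.2
  eqv_empty i j := by
    rw [toBitset_empty]
    exact hF.2.2.2.2.1 i i.2 j j.2
  le_trans {X i j k} _ := hF.2.2.2.2.2.1 _ (toBitset_lt b X) i i.2 j j.2 k k.2
  dD_of_mem {X y} i hX hy := hF.2.2.2.2.2.2.1 _ (toBitset_lt b X) i i.2 _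
    (mem_varsBelow.1 (hX hy)) (testBit_toBitset.2 ⟨mem_varsBelow.1 (hX hy), y, hy, rfl⟩)
  dD_trans {X Y z i} _ _ hz h := hF.2.2.2.2.2.2.2.1 _ (toBitset_lt b X) _ (toBitset_lt b Y) i i.2 _
    (mem_varsBelow.1 hz) (forall_testBit_toBitset h)
  dD_eqv {X y i j} _ hy := hF.2.2.2.2.2.2.2.2.1 _ (toBitset_lt b X) i i.2 j j.2 _
    (mem_varsBelow.1 hy)
  eqv_of_dD {X Y i j} _ _ h := hF.2.2.2.2.2.2.2.2.2.1 _ (toBitset_lt b X) _ (toBitset_lt b Y)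
    i i.2 j j.2 (forall_testBit_toBitset h)
  dK_of_mem {X y} i hX hy := hF.2.2.2.2.2.2.2.2.2.2.1 _ (toBitset_lt b X) i i.2 _
    (mem_varsBelow.1 (hX hy)) (testBit_toBitset.2 ⟨mem_varsBelow.1 (hX hy), y, hy, rfl⟩)
  dK_trans {X Y z i} _ _ hz h := hF.2.2.2.2.2.2.2.2.2.2.2.1 _ (toBitset_lt b X) _
    (toBitset_lt b Y) i i.2 _ (mem_varsBelow.1 hz) (forall_testBit_toBitset h)
  dK_le {X y i j} _ hy := hF.2.2.2.2.2.2.2.2.2.2.2.2.1 _ (toBitset_lt b X) i i.2 j j.2 _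
    (mem_varsBelow.1 hy)
  le_of_dK {X Y i j} _ _ h := hF.2.2.2.2.2.2.2.2.2.2.2.2.2.1 _ (toBitset_lt b X) _
    (toBitset_lt b Y) i i.2 j j.2 (forall_testBit_toBitset h)
  dD_of_dK {X y i} _ hy := hF.2.2.2.2.2.2.2.2.2.2.2.2.2.2.1 _ (toBitset_lt b X) i i.2 _
    (mem_varsBelow.1 hy)
  dK_empty {y i} hy := by
    rw [toBitset_empty]
    exact hF.2.2.2.2.2.2.2.2.2.2.2.2.2.2.2 i i.2 _ (mem_varsBelow.1 hy)
  tr_atom {P xs i j} h := by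
    have hl := lt_and_lt_of_pair_lt (lt_of_pair_lt h.1)
    exact (hT _ h.1 h.2).1 _ hl.1 _ hl.2 rfl _ (toBitset_lt b _)
      (isBitsetOf_toBitset fun y => mem_ofNat_encode_ofFn) i i.2 j j.2
  tr_neg {φ i} h := ((hT _ h.1 h.2).2.1 _ (lt_of_pair_lt h.1) rfl).2 i i.2
  tr_and {φ ψ i} h := by
    have hl := lt_and_lt_of_pair_lt (lt_of_pair_lt h.1)
    exact ((hT _ h.1 h.2).2.2.1 _ hl.1 _ hl.2 rfl).2 i i.2
  tr_dmod {X φ i} h := by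
    have hl := lt_and_lt_of_pair_lt (lt_of_pair_lt h.1)
    rw [((hT _ h.1 h.2).2.2.2.1 _ hl.1 _ hl.2 rfl).2 _ (toBitset_lt b X)
      (isBitsetOf_toBitset fun y => mem_ofNat_encode_finset) i i.2]
    exact ⟨fun h j => h j j.2, fun h j hj => h ⟨j, hj⟩⟩
  tr_kmod {X φ i} h := by
    have hl := lt_and_lt_of_pair_lt (lt_of_pair_lt h.1)
    rw [((hT _ h.1 h.2).2.2.2.2.1 _ hl.1 _ hl.2 rfl).2 _ (toBitset_lt b X)
      (isBitsetOf_toBitset fun y => mem_ofNat_encode_finset) i i.2]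
    exact ⟨fun h j => h j j.2, fun h j hj => h ⟨j, hj⟩⟩
  tr_ddep {X Y i} h := by
    have hl := lt_and_lt_of_pair_lt (lt_of_pair_lt h.1)
    rw [(hT _ h.1 h.2).2.2.2.2.2.1 _ hl.1 _ hl.2 rfl _ (toBitset_lt b X)
      (isBitsetOf_toBitset fun y => mem_ofNat_encode_finset) i i.2]
    refine ⟨fun h y hy => h _ ?_ (mem_ofNat_encode_finset.2 ⟨y, hy, rfl⟩), fun h y _ hy => ?_⟩
    · exact mem_varsBelow.1 (subset_varsBelow hl.2 hy)
    · obtain ⟨x, hx, rfl⟩ := mem_ofNat_encode_finset.1 hy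
      exact h x hx
  tr_kdep {X Y i} h := by
    have hl := lt_and_lt_of_pair_lt (lt_of_pair_lt h.1)
    rw [(hT _ h.1 h.2).2.2.2.2.2.2 _ hl.1 _ hl.2 rfl _ (toBitset_lt b X)
      (isBitsetOf_toBitset fun y => mem_ofNat_encode_finset) i i.2]
    refine ⟨fun h y hy => h _ ?_ (mem_ofNat_encode_finset.2 ⟨y, hy, rfl⟩), fun h y _ hy => ?_⟩
    · exact mem_varsBelow.1 (subset_varsBelow hl.2 hy)
    · obtain ⟨x, hx, rfl⟩ := mem_ofNat_encode_finset.1 hy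
      exact h x hx

/-- Any coded premodel unravels to a countermodel, whether or not it arises from maximal consistent
sets, so the search has no false positives. -/
theorem not_validTopo_of_natRefutes {φ : Formula Var Pred ar} (hφ : φ.code < b)
    (h : NatRefutes φ.code b N (2 ^ b) Q) : ¬ ValidTopo.{u, v, w, w'} φ := by
  obtain ⟨hF, hT, hm, i, hi, hn⟩ := h
  intro hv
  obtain ⟨H, -, hH⟩ := (premodelOfCode (Var := Var) (Pred := Pred) (ar := ar) hF hT
    ).exists_metricDepModel.{u, v, w, w'} (isClosedUnder_markedFormulas hT) (a := ⟨i, hi⟩)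
    (φ := φ) ⟨hφ, hm⟩ hn
  exact hH (hv _)

end OfCode

/-! ### From a premodel to a coded one, and the decision procedure. -/

section ToCode

theorem pair_lt_pair {a₁ a₂ b₁ b₂ : ℕ} (h₁ : a₁ < a₂) (h₂ : b₁ < b₂) :
    Nat.pair a₁ b₁ < Nat.pair a₂ b₂ :=
  (Nat.pair_lt_pair_left b₁ h₁).trans (Nat.pair_lt_pair_right a₂ h₂)

/-- Strict monotonicity of the pairing function puts every relevant bit position below `bitBound b`.
-/
theorem exists_bitRel_iff (b : ℕ) (Q : ℕ → ℕ → ℕ → ℕ → Prop) :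
    ∃ m < 2 ^ bitBound b, ∀ k < 6, ∀ x < stateBound b + 2 ^ b + b,
      ∀ y < stateBound b + 2 ^ b + b, ∀ z < stateBound b + 2 ^ b + b,
        (bitRel m k x y z ↔ Q k x y z) := by
  obtain ⟨m, hm, h⟩ := exists_testBit_iff (bitBound b) fun t =>
    Q t.unpair.1 t.unpair.2.unpair.1 t.unpair.2.unpair.2.unpair.1 t.unpair.2.unpair.2.unpair.2
  refine ⟨m, hm, fun k hk x hx y hy z hz => ?_⟩
  rw [bitRel, h]
  simp only [Nat.unpair_pair]
  exact and_iff_right (pair_lt_pair hk (pair_lt_pair hx (pair_lt_pair hy hz)))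

variable {Var : Type u} {Pred : Type v} {ar : Pred → ℕ} [DecidableEq Var] [Encodable Var]
  [Encodable Pred] {b : ℕ} {S : Set (Formula Var Pred ar)}

/-- The relations of a premodel, read as relations between codes. -/
def Premodel.natRel {N : ℕ} (M : Premodel (varsBelow Var b) S (Fin N)) (ι : ℕ → Fin N) :
    ℕ → ℕ → ℕ → ℕ → Prop
  | 0, X, i, j => M.eqv (ofBitset Var b X) (ι i) (ι j)
  | 1, X, i, j => M.le (ofBitset Var b X) (ι i) (ι j)
  | 2, i, X, y => ∀ x : Var, Encodable.encode x = y → M.dD (ι i) (ofBitset Var b X) x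
  | 3, i, X, y => ∀ x : Var, Encodable.encode x = y → M.dK (ι i) (ofBitset Var b X) x
  | 4, i, c, _ => ∃ φ : Formula Var Pred ar, φ.code = c ∧ M.tr (ι i) φ
  | _, c, _, _ => ∃ φ : Formula Var Pred ar, φ ∈ S ∧ φ.code = c

theorem exists_natRefutes {N : ℕ} (hN : N = stateBound b)
    (hS : IsClosedUnder (varsBelow Var b) S) (hSb : ∀ φ ∈ S, φ.code < b)
    (M : Premodel (varsBelow Var b) S (Fin N)) {φ : Formula Var Pred ar} (hφ : φ ∈ S) {a : Fin N}
    (ha : ¬ M.tr a φ) :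
    ∃ m < 2 ^ bitBound b, NatRefutes φ.code b N (2 ^ b) (bitRel m) := by
  -- The default `a` is irrelevant, since the conditions only concern indices below `N`.
  let ι : ℕ → Fin N := fun i => if h : i < N then ⟨i, h⟩ else a
  have hι : ∀ i : Fin N, ι i = i := fun i => dif_pos i.2
  obtain ⟨m, hm, hQ⟩ := exists_bitRel_iff b (M.natRel ι)
  rw [← hN] at hQ
  have hb0 : 0 < N + 2 ^ b + b := by positivity
  have hP : ∀ {X}, X < 2 ^ b → X < N + 2 ^ b + b := fun h =>
    h.trans_le ((Nat.le_add_left _ _).trans (Nat.le_add_right _ _))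
  have hV : ∀ {y}, y < b → y < N + 2 ^ b + b := fun h => h.trans_le (Nat.le_add_left _ _)
  have hW : ∀ {i}, i < N → i < N + 2 ^ b + b := fun h =>
    h.trans_le ((Nat.le_add_right _ _).trans (Nat.le_add_right _ _))
  have hE : ∀ {X i j}, X < 2 ^ b → i < N → j < N →
      (bitRel m 0 X i j ↔ M.eqv (ofBitset Var b X) (ι i) (ι j)) := fun hX hi hj =>
    hQ 0 (by omega) _ (hP hX) _ (hW hi) _ (hW hj)
  have hL : ∀ {X i j}, X < 2 ^ b → i < N → j < N →
      (bitRel m 1 X i j ↔ M.le (ofBitset Var b X) (ι i) (ι j)) := fun hX hi hj =>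
    hQ 1 (by omega) _ (hP hX) _ (hW hi) _ (hW hj)
  have hD : ∀ {X i y}, X < 2 ^ b → i < N → y < b → (bitRel m 2 i X y ↔
      ∀ x : Var, Encodable.encode x = y → M.dD (ι i) (ofBitset Var b X) x) := fun hX hi hy =>
    hQ 2 (by omega) _ (hW hi) _ (hP hX) _ (hV hy)
  have hK : ∀ {X i y}, X < 2 ^ b → i < N → y < b → (bitRel m 3 i X y ↔
      ∀ x : Var, Encodable.encode x = y → M.dK (ι i) (ofBitset Var b X) x) := fun hX hi hy =>
    hQ 3 (by omega) _ (hW hi) _ (hP hX) _ (hV hy)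
  have hT : ∀ {i} {ψ : Formula Var Pred ar}, i < N → ψ ∈ S →
      (bitRel m 4 i ψ.code 0 ↔ M.tr (ι i) ψ) := fun {i ψ} hi hψ =>
    (hQ 4 (by omega) _ (hW hi) _ (hV (hSb ψ hψ)) _ hb0).trans
      ⟨fun ⟨ψ', h, h'⟩ => code_injective h ▸ h', fun h => ⟨ψ, rfl, h⟩⟩
  have hR : ∀ {c}, c < b → (bitRel m 5 c 0 0 ↔ ∃ ψ : Formula Var Pred ar, ψ ∈ S ∧ ψ.code = c) :=
    fun hc => hQ 5 (by omega) _ (hV hc) _ hb0 _ hb0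
  have hR' : ∀ {ψ : Formula Var Pred ar}, ψ ∈ S → bitRel m 5 ψ.code 0 0 := fun {ψ} hψ =>
    (hR (hSb ψ hψ)).2 ⟨ψ, hψ, rfl⟩
  have hDall : ∀ {X Y i}, X < 2 ^ b → i < N →
      (∀ y < b, Nat.testBit Y y = true → bitRel m 2 i X y) →
      ∀ y ∈ ofBitset Var b Y, M.dD (ι i) (ofBitset Var b X) y := fun hX hi h y hy =>
    have hy' := mem_ofBitset.1 hy
    (hD hX hi hy'.1).1 (h _ hy'.1 hy'.2) y rfl
  have hKall : ∀ {X Y i}, X < 2 ^ b → i < N →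
      (∀ y < b, Nat.testBit Y y = true → bitRel m 3 i X y) →
      ∀ y ∈ ofBitset Var b Y, M.dK (ι i) (ofBitset Var b X) y := fun hX hi h y hy =>
    have hy' := mem_ofBitset.1 hy
    (hK hX hi hy'.1).1 (h _ hy'.1 hy'.2) y rfl
  have h0 : 0 < 2 ^ b := by positivity
  refine ⟨m, hm, ⟨?_, ?_, ?_, ?_, ?_, ?_, ?_, ?_, ?_, ?_, ?_, ?_, ?_, ?_, ?_, ?_⟩, ?_, hR' hφ,
    a, a.2, ?_⟩
  · exact fun X hX i hi => (hE hX hi hi).2 (M.eqv_refl _ ofBitset_subset)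
  · intro X hX i hi j hj
    rw [hE hX hi hj, hE hX hj hi]
    exact M.eqv_symm ofBitset_subset
  · intro X hX i hi j hj k hk
    rw [hE hX hi hj, hE hX hj hk, hE hX hi hk]
    exact M.eqv_trans ofBitset_subset
  · intro X hX i hi j hj
    rw [hE hX hi hj, hL hX hi hj]
    exact M.eqv_le ofBitset_subset
  · intro i hi j hj
    rw [hE h0 hi hj, ofBitset_zero]
    exact M.eqv_empty _ _
  · intro X hX i hi j hj k hk
    rw [hL hX hi hj, hL hX hj hk, hL hX hi hk]
    exact M.le_trans ofBitset_subset
  · intro X hX i hi y hy hm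
    -- A number `y` that codes no variable satisfies the coded dependence vacuously.
    refine (hD hX hi hy).2 fun x hx => M.dD_of_mem _ ofBitset_subset (mem_ofBitset.2 ?_)
    rw [hx]
    exact ⟨hy, hm⟩
  · intro X hX Y hY i hi z hz h₁ h₂
    rw [hD hY hi hz] at h₂
    exact (hD hX hi hz).2 fun x hx => M.dD_trans ofBitset_subset ofBitset_subset
      (mem_varsBelow_of_encode_eq hz hx) (hDall hX hi h₁) (h₂ x hx)
  · intro X hX i hi j hj y hy
    rw [hE hX hi hj, hD hX hi hy, hD hX hj hy]
    exact fun h₁ h₂ x hx => M.dD_eqv ofBitset_subset (mem_varsBelow_of_encode_eq hy hx) h₁ (h₂ x hx)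
  · intro X hX Y hY i hi j hj h₁
    rw [hE hX hi hj, hE hY hi hj]
    exact M.eqv_of_dD ofBitset_subset ofBitset_subset (hDall hX hi h₁)
  · intro X hX i hi y hy hm
    refine (hK hX hi hy).2 fun x hx => M.dK_of_mem _ ofBitset_subset (mem_ofBitset.2 ?_)
    rw [hx]
    exact ⟨hy, hm⟩
  · intro X hX Y hY i hi z hz h₁ h₂
    rw [hK hY hi hz] at h₂
    exact (hK hX hi hz).2 fun x hx => M.dK_trans ofBitset_subset ofBitset_subset
      (mem_varsBelow_of_encode_eq hz hx) (hKall hX hi h₁) (h₂ x hx)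
  · intro X hX i hi j hj y hy
    rw [hL hX hi hj, hK hX hi hy, hK hX hj hy]
    exact fun h₁ h₂ x hx => M.dK_le ofBitset_subset (mem_varsBelow_of_encode_eq hy hx) h₁ (h₂ x hx)
  · intro X hX Y hY i hi j hj h₁
    rw [hL hX hi hj, hL hY hi hj]
    exact M.le_of_dK ofBitset_subset ofBitset_subset (hKall hX hi h₁)
  · intro X hX i hi y hy
    rw [hK hX hi hy, hD hX hi hy]
    exact fun h x hx => M.dD_of_dK ofBitset_subset (mem_varsBelow_of_encode_eq hy hx) (h x hx)
  · intro i hi y hy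
    rw [hD h0 hi hy, hK h0 hi hy, ofBitset_zero]
    exact fun h x hx => M.dK_empty (mem_varsBelow_of_encode_eq hy hx) (h x hx)
  · intro c hc hcR
    obtain ⟨ψ, hψ, rfl⟩ := (hR hc).1 hcR
    refine ⟨?_, ?_, ?_, ?_, ?_, ?_, ?_⟩
    · intro p _ l _ h X hX hXl i hi j hj
      -- The leading tags of the codes exclude all constructors but one.
      cases ψ <;> simp only [code, Nat.pair_eq_pair] at h <;> try omega
      obtain ⟨-, -, rfl⟩ := h
      rw [hE hX hi hj, hT hi hψ, hT hj hψ, ofBitset_eq_of_isBitsetOf (hS.atom _ _ hψ)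
        (fun y => mem_ofNat_encode_ofFn) hXl]
      exact M.tr_atom hψ
    · intro d _ h
      cases ψ <;> simp only [code, Nat.pair_eq_pair] at h <;> try omega
      obtain ⟨-, rfl⟩ := h
      have hs := hS.neg _ hψ
      refine ⟨hR' hs, fun i hi => ?_⟩
      rw [hT hi hψ, hT hi hs]
      exact M.tr_neg hψ
    · intro d _ e _ h
      cases ψ <;> simp only [code, Nat.pair_eq_pair] at h <;> try omega
      obtain ⟨-, rfl, rfl⟩ := h
      have hs := hS.and _ _ hψ
      refine ⟨⟨hR' hs.1, hR' hs.2⟩, fun i hi => ?_⟩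
      rw [hT hi hψ, hT hi hs.1, hT hi hs.2]
      exact M.tr_and hψ
    · intro l _ d _ h
      cases ψ <;> simp only [code, Nat.pair_eq_pair] at h <;> try omega
      obtain ⟨-, rfl, rfl⟩ := h
      have hs := hS.dmod _ _ hψ
      refine ⟨hR' hs.2, fun X hX hXl i hi => ?_⟩
      rw [hT hi hψ, M.tr_dmod hψ]
      have hXe := ofBitset_eq_of_isBitsetOf hs.1 (fun y => mem_ofNat_encode_finset) hXl
      refine ⟨fun h j hj => ?_, fun h j => ?_⟩
      · rw [hE hX hi hj, hT hj hs.2, hXe]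
        exact h _
      · have := h j j.2
        rwa [hE hX hi j.2, hT j.2 hs.2, hXe, hι] at this
    · intro l _ d _ h
      cases ψ <;> simp only [code, Nat.pair_eq_pair] at h <;> try omega
      obtain ⟨-, rfl, rfl⟩ := h
      have hs := hS.kmod _ _ hψ
      refine ⟨hR' hs.2, fun X hX hXl i hi => ?_⟩
      rw [hT hi hψ, M.tr_kmod hψ]
      have hXe := ofBitset_eq_of_isBitsetOf hs.1 (fun y => mem_ofNat_encode_finset) hXl
      refine ⟨fun h j hj => ?_, fun h j => ?_⟩
      · rw [hL hX hi hj, hT hj hs.2, hXe]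
        exact h _
      · have := h j j.2
        rwa [hL hX hi j.2, hT j.2 hs.2, hXe, hι] at this
    · intro l _ k _ h X hX hXl i hi
      cases ψ <;> simp only [code, Nat.pair_eq_pair] at h <;> try omega
      obtain ⟨-, rfl, rfl⟩ := h
      have hs := hS.ddep _ _ hψ
      have hXe := ofBitset_eq_of_isBitsetOf hs.1 (fun y => mem_ofNat_encode_finset) hXl
      rw [hT hi hψ, M.tr_ddep hψ, ← hXe]
      refine ⟨fun h y hy hm => (hD hX hi hy).2 fun x hx => h x ?_, fun h y hy => ?_⟩
      · obtain ⟨x', hx', rfl⟩ := mem_ofNat_encode_finset.1 hm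
        rwa [Encodable.encode_injective hx]
      · have hyb := mem_varsBelow.1 (hs.2 hy)
        exact (hD hX hi hyb).1 (h _ hyb (mem_ofNat_encode_finset.2 ⟨y, hy, rfl⟩)) y rfl
    · intro l _ k _ h X hX hXl i hi
      cases ψ <;> simp only [code, Nat.pair_eq_pair] at h <;> try omega
      obtain ⟨-, rfl, rfl⟩ := h
      have hs := hS.kdep _ _ hψ
      have hXe := ofBitset_eq_of_isBitsetOf hs.1 (fun y => mem_ofNat_encode_finset) hXl
      rw [hT hi hψ, M.tr_kdep hψ, ← hXe]
      refine ⟨fun h y hy hm => (hK hX hi hy).2 fun x hx => h x ?_, fun h y hy => ?_⟩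
      · obtain ⟨x', hx', rfl⟩ := mem_ofNat_encode_finset.1 hm
        rwa [Encodable.encode_injective hx]
      · have hyb := mem_varsBelow.1 (hs.2 hy)
        exact (hK hX hi hyb).1 (h _ hyb (mem_ofNat_encode_finset.2 ⟨y, hy, rfl⟩)) y rfl
  · rwa [hT a.2 hφ, hι]

/-- With `b = φ.code + 1` the closed set consists of all formulas with code at most that of `φ`; its
size and the number of variables are at most `b`, so the filtrated premodel fits into `stateBound b`
states. -/
theorem exists_natRefutes_iff {φ : Formula Var Pred ar} :
    (∃ m < 2 ^ bitBound (φ.code + 1), NatRefutes φ.code (φ.code + 1) (stateBound (φ.code + 1))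
      (2 ^ (φ.code + 1)) (bitRel m)) ↔ ¬ ValidTopo.{u, v, w, w'} φ := by
  constructor
  · rintro ⟨m, -, hm⟩
    exact not_validTopo_of_natRefutes (Nat.lt_succ_self _) hm
  · intro h
    rw [← provable_iff_validTopo] at h
    have hφ : φ ∈ formulasBelow Var Pred ar (φ.code + 1) :=
      mem_formulasBelow.2 (Nat.lt_succ_self _)
    have hN : 2 ^ ((formulasBelow Var Pred ar (φ.code + 1)).card +
        2 * (2 ^ (varsBelow Var (φ.code + 1)).card * (varsBelow Var (φ.code + 1)).card)) ≤
        stateBound (φ.code + 1) := by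
      have h₁ := card_formulasBelow_le (Var := Var) (Pred := Pred) (ar := ar) (φ.code + 1)
      have h₂ := card_varsBelow_le (Var := Var) (φ.code + 1)
      unfold stateBound
      gcongr <;> norm_num
    obtain ⟨M, a, ha⟩ := exists_premodel_of_card (isClosedUnder_formulasBelow _) hN hφ h
    exact exists_natRefutes rfl (isClosedUnder_formulasBelow _)
      (fun ψ hψ => mem_formulasBelow.1 hψ) M hφ ha

theorem exists_computable_validTopo (Var : Type u) (Pred : Type v) (ar : Pred → ℕ)
    [DecidableEq Var] [Encodable Var] [Encodable Pred] :
    ∃ f : ℕ → Bool, Computable f ∧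
      ∀ φ : Formula Var Pred ar, f φ.code = true ↔ ValidTopo.{u, v, w, w'} φ := by
  classical
  refine ⟨_, primrecPred_exists_natRefutes.not.decide.to_comp, fun φ => ?_⟩
  rw [decide_eq_true_iff, exists_natRefutes_iff.{u, v, w, w'}, not_not]

end ToCode

end LCD

theorem mainTheorem1 {Var : Type u} {Pred : Type v} [DecidableEq Var]
    (ar : Pred → ℕ) :
    (∀ φ : LCD.Formula Var Pred ar, LCD.Provable φ ↔ LCD.ValidTopo.{u, v, w, w'} φ) ∧
    (∀ φ : LCD.Formula Var Pred ar, LCD.Provable φ ↔ LCD.ValidMetric.{u, v, w, w'} φ) ∧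
    (∀ φ : LCD.Formula Var Pred ar, LCD.Provable φ ↔ LCD.ValidConcrete.{u, v, w} φ) ∧
    (∀ φ : LCD.Formula Var Pred ar,
      LCD.Provable φ ↔ LCD.ValidPseudoLocallyLipschitz.{u, v, w, w'} φ) ∧
    (∀ [Encodable Var] [Encodable Pred],
      ∃ f : ℕ → Bool, Computable f ∧
        ∀ φ : LCD.Formula Var Pred ar,
          f φ.code = true ↔ LCD.ValidTopo.{u, v, w, w'} φ) := by
  refine ⟨LCD.provable_iff_validTopo, LCD.provable_iff_validMetric,
    LCD.provable_iff_validConcrete, LCD.provable_iff_validPseudoLocallyLipschitz, ?_⟩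
  intro _ _
  exact LCD.exists_computable_validTopo Var Pred ar
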